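/- **Setting.** Let $3\le p\le K$, $\phi_1,\dots,\phi_K>0$, $\sigma>0$. Let $v_1,\dots,v_d$ be an orthonormal basis of $\mathbb R^d$, $d>K$: $v_1$ is the class feature, $v_2$ the subclass feature, $v_3,\dots,v_K$ are irrelevant features and $v_{K+1},\dots,v_d$ are noise directions. A data point is $x=\sum_{k\le K}\phi_k\tau_k v_k+\xi$ with signs $\tau_k\in\{\pm1\}$, class label $\tau_1$, subclass label $\tau_2$, and noise $\xi$ uniform on $\{\pm\sigma v_j: K<j\le d\}$. The training set consists of $n\ge1$ examples with sign vectors $\tau^{(1)},\dots,\tau^{(n)}$ and, for each example, $m\ge1$ augmentations with the same signs and fresh noise, all $nm$ noise draws being independent. The examples are balanced: $\sum_i\tau^{(i)}_k=0$ for all $k$, and $\sum_i\tau^{(i)}_k\tau^{(i)}_l=0$ for $k\ne l$ (so $\phi_k^2$ is the variance of feature $k$). The model is $f_\Theta(x)=Wx+b$, $\Theta=[W\ b]\in\mathbb R^{p\times(d+1)}$. A contrastive loss is $$L(\Theta)=-2\,\mathbb E\big[f_\Theta(x)^\top f_\Theta(x^+)\big]+\mathbb E\big[(f_\Theta(x)^\top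 f_\Theta(x^-))^2\big],$$ where $x,x^-$ are independent and uniform on the training set and, given $x$, the positive $x^+$ is uniform on the training points with the class label of $x$ (for $L_{SCL}$) or on the augmentations of the same example as $x$ (for $L_{UCL}$). Put $L_{joint,\beta}=\beta L_{SCL}+(1-\beta)L_{UCL}$. A minimum-norm minimizer is a global minimizer of least Frobenius norm $\|\Theta\|_F$. A linear classifier on $f_\Theta$ predicts a label by the sign of $w^\top f_\Theta(x)+t$, $w\in\mathbb R^p$, $t\in\mathbb R$; it is better than random guessing if it is correct with probability $>1/2$ on a fresh test point, whose signs $\tau_1,\dots,\tau_K$ and noise $\xi$ are independent and uniform. **Theorem.** Assume $\phi_3^2\ge\dots\ge\phi_K^2$, $\phi_1^2<\phi_2^2$, $\phi_p^2<\phi_2^2$, and that $\phi_1^2$ is not among the $p$ largest entries of $(1,\phi_1^2,\dots,\phi_K^2)$, i.e. at least $p$ entries are strictly larger than $\phi_1^2$. Let $\beta\in(0,1)$. Then there are constants $C,c>0$, depending only on $K,p,\sigma,\beta$ and $\phi_1,\dots,\phi_K$, such that for all $d>K$, $n,m\ge1$, all orthonormal bases and all balanced examples, with probability at least $1-C\,n^2m^2/d$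 over the noise of the training set, the following hold simultaneously. 1. (Class collapse of $L_{SCL}$) $L_{SCL}$ has a minimum-norm minimizer, and every such minimizer has $\|Wv_2\|=0$, and no linear classifier on $f_\Theta$ predicts the subclass label better than random guessing. 2. (Feature suppression of $L_{UCL}$) $L_{UCL}$ has a global minimizer with $\|Wv_1\|\ge c$; it has a minimum-norm minimizer, and every such minimizer has $\|Wv_1\|=0$. 3. (The joint loss avoids both) $L_{joint,\beta}$ has a minimum-norm minimizer, and every such minimizer has $\|Wv_1\|\ge c$ and $\|Wv_2\|\ge c$, and for each of the class label and the subclass label some linear classifier on $f_\Theta$ predicts it better than random guessing. -/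

import Mathlib

open scoped BigOperators Matrix

noncomputable section

namespace ContrastiveLearning

/-- The probability of the event `S` under the uniform law on the finite type `Ω`. -/
def uniformProb {Ω : Type*} [Fintype Ω] (S : Set Ω) : ℝ :=
  (S.ncard : ℝ) / (Fintype.card Ω : ℝ)

/-- The parameters `Θ = [W b]` of a linear model with `p` outputs on `ℝ^d`. -/
abbrev Params (p d : ℕ) : Type := Matrix (Fin p) (Fin d) ℝ × (Fin p → ℝ)

/-- The linear model `f_Θ(x) = W x + b`. -/
def model {p d : ℕ} (Θ : Params p d) (x : EuclideanSpace ℝ (Fin d)) :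
    EuclideanSpace ℝ (Fin p) :=
  WithLp.toLp 2 (Θ.1 *ᵥ x.ofLp + Θ.2)

/-- The alignment `‖W v‖` (Euclidean norm) of the weights with a direction `v`. -/
def alignment {p d : ℕ} (Θ : Params p d) (v : EuclideanSpace ℝ (Fin d)) : ℝ :=
  ‖(WithLp.toLp 2 (Θ.1 *ᵥ v.ofLp) : EuclideanSpace ℝ (Fin p))‖

/-- The Frobenius norm of the concatenated parameter `Θ = [W b]`. -/
def frobeniusNorm {p d : ℕ} (Θ : Params p d) : ℝ :=
  Real.sqrt ((∑ i, ∑ j, Θ.1 i j ^ 2) + ∑ i, Θ.2 i ^ 2)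

/-- `Θ` is a global minimizer of `L`. -/
def IsMinimizer {p d : ℕ} (L : Params p d → ℝ) (Θ : Params p d) : Prop :=
  ∀ Θ', L Θ ≤ L Θ'

/-- `Θ` is a global minimizer of `L` of smallest Frobenius norm. -/
def IsMinNormMinimizer {p d : ℕ} (L : Params p d → ℝ) (Θ : Params p d) : Prop :=
  IsMinimizer L Θ ∧ ∀ Θ', IsMinimizer L Θ' → frobeniusNorm Θ ≤ frobeniusNorm Θ'

/-- The spectral contrastive loss
`-2 E[f(x)ᵀ f(x⁺)] + E[(f(x)ᵀ f(x⁻))²]` of the finite data set `X`: here `x` and `x⁻` are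
independent uniform data points, and `x⁺` is uniform among the data points whose group (given
by `g`) is that of `x`. -/
def contrastiveLoss {ι κ : Type*} [Fintype ι] [DecidableEq κ] {p d : ℕ}
    (X : ι → EuclideanSpace ℝ (Fin d)) (g : ι → κ) (Θ : Params p d) : ℝ :=
  -2 * (𝔼 a, 𝔼 b with g b = g a, inner ℝ (model Θ (X a)) (model Θ (X b)))
    + 𝔼 a, 𝔼 b, (inner ℝ (model Θ (X a)) (model Θ (X b))) ^ 2

/-- A noise draw: one of the `q` noise directions and a sign. -/
abbrev NoiseDraw (q : ℕ) : Type := Fin q × ℤˣ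

/-- The data point `∑ₖ φₖ τₖ vₖ + ξ` with feature signs `τ`, where the noise `ξ` is plus or minus
`σ` times a noise direction. The orthonormal basis `v` consists of the `K` features
`v (Sum.inl k)` and of the `q` noise directions `v (Sum.inr j)`. -/
def dataPoint {K q d : ℕ}
    (v : OrthonormalBasis (Fin K ⊕ Fin q) ℝ (EuclideanSpace ℝ (Fin d)))
    (φ : Fin K → ℝ) (σ : ℝ) (τ : Fin K → ℤˣ) (ξ : NoiseDraw q) : EuclideanSpace ℝ (Fin d) :=
  (∑ k, (φ k * ((τ k : ℤ) : ℝ)) • v (Sum.inl k)) + (σ * ((ξ.2 : ℤ) : ℝ)) • v (Sum.inr ξ.1)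

/-- The training set: the `j`-th augmentation of the `i`-th example keeps the features of that
example and carries its own noise `ω (i, j)`. -/
def trainingSet {K q d n m : ℕ}
    (v : OrthonormalBasis (Fin K ⊕ Fin q) ℝ (EuclideanSpace ℝ (Fin d)))
    (φ : Fin K → ℝ) (σ : ℝ) (τ : Fin n → Fin K → ℤˣ) (ω : Fin n × Fin m → NoiseDraw q) :
    Fin n × Fin m → EuclideanSpace ℝ (Fin d) :=
  fun a => dataPoint v φ σ (τ a.1) (ω a)

/-- The examples are balanced: every feature sign is centered over the examples, and distinct
feature signs are uncorrelated over the examples (for instance, every sign pattern occurs equally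
often). Hence the variance of the data along the `k`-th feature is `φ k ^ 2`. -/
def BalancedSigns {n K : ℕ} (τ : Fin n → Fin K → ℤˣ) : Prop :=
  (∀ k, ∑ i, (τ i k : ℤ) = 0) ∧ ∀ k l, k ≠ l → ∑ i, (τ i k : ℤ) * (τ i l : ℤ) = 0

/-- The supervised loss: the positive pairs are the data points with the same class label
`y i = τ i c`, where `c` is the class feature. -/
def lossSCL {n m K p d : ℕ} (c : Fin K) (τ : Fin n → Fin K → ℤˣ)
    (X : Fin n × Fin m → EuclideanSpace ℝ (Fin d)) (Θ : Params p d) : ℝ :=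
  contrastiveLoss X (fun a => τ a.1 c) Θ

/-- The unsupervised loss: the positive pairs are the augmentations of the same example. -/
def lossUCL {n m p d : ℕ} (X : Fin n × Fin m → EuclideanSpace ℝ (Fin d)) (Θ : Params p d) : ℝ :=
  contrastiveLoss X (fun a => a.1) Θ

/-- The joint loss `β L_SCL + (1 - β) L_UCL`. -/
def lossJoint {n m K p d : ℕ} (β : ℝ) (c : Fin K) (τ : Fin n → Fin K → ℤˣ)
    (X : Fin n × Fin m → EuclideanSpace ℝ (Fin d)) (Θ : Params p d) : ℝ :=
  β * lossSCL c τ X Θ + (1 - β) * lossUCL X Θ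

/-- The probability that the linear classifier `sign (⟪w, f_Θ(x)⟫ + t)` on the representation
predicts the sign of the `k`-th feature of a fresh test point `x`, whose feature signs and noise
are all independent and uniform. -/
def testAccuracy {K q p d : ℕ}
    (v : OrthonormalBasis (Fin K ⊕ Fin q) ℝ (EuclideanSpace ℝ (Fin d)))
    (φ : Fin K → ℝ) (σ : ℝ) (Θ : Params p d) (k : Fin K)
    (w : EuclideanSpace ℝ (Fin p)) (t : ℝ) : ℝ :=
  uniformProb {z : (Fin K → ℤˣ) × NoiseDraw q |
    0 < ((z.1 k : ℤ) : ℝ) * (inner ℝ w (model Θ (dataPoint v φ σ z.1 z.2)) + t)}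

/-- No linear classifier on the representation predicts the sign of the `k`-th feature of a test
point better than random guessing. -/
def NoBetterThanRandom {K q p d : ℕ}
    (v : OrthonormalBasis (Fin K ⊕ Fin q) ℝ (EuclideanSpace ℝ (Fin d)))
    (φ : Fin K → ℝ) (σ : ℝ) (Θ : Params p d) (k : Fin K) : Prop :=
  ∀ w t, testAccuracy v φ σ Θ k w t ≤ 1 / 2

/-- The tuple `(1, φ₁², …, φ_K²)`; the entry `1` is indexed by `none`. -/
def varianceTuple {K : ℕ} (φ : Fin K → ℝ) : Option (Fin K) → ℝ
  | none => 1
  | some k => φ k ^ 2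

/-- The `i`-th entry is among the `p` largest ones: fewer than `p` entries exceed it. -/
def IsAmongLargest {ι : Type*} (p : ℕ) (L : ι → ℝ) (i : ι) : Prop :=
  {j | L i < L j}.ncard < p

end ContrastiveLearning

end

open ContrastiveLearning

/-! When all the noise directions of the training set are distinct, each training point owns a
private direction that can absorb any residual, so every map `Z` from the training points to `ℝ^p`
is the representation of some linear model. Minimizing a loss over `Θ` is then minimizing it over
`Z`, and the minimum norm only selects among the optimal `Z` (`isMinimizer_iff`,
`IsMinNormMinimizer.isOptimalRepresentation`).

Balance says that the constant and the feature signs `h_o` are orthonormal for the average over the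
training points. With `ζ_o = 𝔼 h_o Z` and `N = nm`, completing the square (`frobeniusNorm_sq_eq`)
gives the least squared norm of a model realizing `Z` as `N/σ² 𝔼‖Z‖² - ∑ saving_o ‖ζ_o‖²`, attained
when the weight along feature `o` is `gain_o ζ_o`. The saving is strictly increasing in the variance
of the feature, so short models prefer features of large variance.

The losses constrain `Z` by completed squares. For SCL, optimality means `⟪Z a, Z b⟫ = 1 + y a y b`,
which kills `ζ_o` for every feature but the class. For UCL, it forces the second moment matrix to be
the identity, hence `‖ζ_o‖² ≤ 1` and `∑ ‖ζ_o‖² ≤ p`. For the joint loss, after a rotation, two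
coordinates span the constant and the class with weight `1`, and the others have weight `1 - β`,
hence `‖ζ_o‖² ≤ 1 - β` and a total of at most `(1 - β)(p - 2)` for the remaining features.

Minimizing the norm is thus a linear program in the `‖ζ_o‖²`, solved by filling the largest
variances (`sum_mul_le_of_threshold`): UCL drops the class, while the joint loss keeps the class by
optimality and the subclass by its variance. A union bound over collisions of noise directions gives
the probability. -/

noncomputable section

namespace ContrastiveLearning

/-! ### Correlations, second moments and Bessel's inequality -/

section Moments

variable {ι : Type*} [Fintype ι] {p : ℕ}

/-- The correlation `𝔼 h Z` of a representation `Z` with a real function `h`. -/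
def featureMean (h : ι → ℝ) (Z : ι → EuclideanSpace ℝ (Fin p)) : EuclideanSpace ℝ (Fin p) :=
  WithLp.toLp 2 fun i => 𝔼 a, h a * Z a i

/-- The uncentered covariance matrix of a representation. -/
def secondMoment (Z : ι → EuclideanSpace ℝ (Fin p)) (i j : Fin p) : ℝ := 𝔼 a, Z a i * Z a j

theorem featureMean_apply (h : ι → ℝ) (Z : ι → EuclideanSpace ℝ (Fin p)) (i : Fin p) :
    featureMean h Z i = 𝔼 a, h a * Z a i := rfl

theorem inner_eq_sum (x y : EuclideanSpace ℝ (Fin p)) : inner ℝ x y = ∑ i, x i * y i := by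
  simp [PiLp.inner_apply, mul_comm]

theorem norm_sq_eq_sum (x : EuclideanSpace ℝ (Fin p)) : ‖x‖ ^ 2 = ∑ i, x i ^ 2 := by
  rw [EuclideanSpace.norm_sq_eq]; simp

theorem inner_featureMean (h : ι → ℝ) (Z : ι → EuclideanSpace ℝ (Fin p))
    (x : EuclideanSpace ℝ (Fin p)) :
    inner ℝ x (featureMean h Z) = 𝔼 a, h a * inner ℝ x (Z a) := by
  simp only [inner_eq_sum, featureMean_apply, Finset.mul_expect, Finset.mul_sum]
  rw [Finset.expect_sum_comm]
  refine Finset.sum_congr rfl fun i _ => Finset.expect_congr rfl fun a _ => by ring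

theorem expect_norm_sq (Z : ι → EuclideanSpace ℝ (Fin p)) :
    𝔼 a, ‖Z a‖ ^ 2 = ∑ i, secondMoment Z i i := by
  simp only [norm_sq_eq_sum, secondMoment, Finset.expect_sum_comm, ← sq]

theorem expect_expect_inner_sq (Z : ι → EuclideanSpace ℝ (Fin p)) :
    𝔼 a, 𝔼 b, (inner ℝ (Z a) (Z b)) ^ 2 = ∑ i, ∑ j, secondMoment Z i j ^ 2 := by
  simp only [inner_eq_sum, sq, Finset.sum_mul_sum, Finset.expect_sum_comm, secondMoment,
    Finset.expect_mul_expect]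
  refine Finset.sum_congr rfl fun i _ => Finset.sum_congr rfl fun j _ =>
    Finset.expect_congr rfl fun a _ => Finset.expect_congr rfl fun b _ => by ring

theorem norm_featureMean_sq (h : ι → ℝ) (Z : ι → EuclideanSpace ℝ (Fin p)) :
    ‖featureMean h Z‖ ^ 2 = 𝔼 a, 𝔼 b, h a * h b * inner ℝ (Z a) (Z b) := by
  rw [← real_inner_self_eq_norm_sq, inner_featureMean]
  refine Finset.expect_congr rfl fun a _ => ?_
  rw [real_inner_comm, inner_featureMean, Finset.mul_expect]
  refine Finset.expect_congr rfl fun b _ => by ring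

theorem expect_inner_sq (Z : ι → EuclideanSpace ℝ (Fin p)) (x : EuclideanSpace ℝ (Fin p)) :
    𝔼 a, (inner ℝ x (Z a)) ^ 2 = ∑ i, ∑ j, x i * x j * secondMoment Z i j := by
  simp only [inner_eq_sum, sq, Finset.sum_mul_sum, Finset.expect_sum_comm, secondMoment,
    Finset.mul_expect]
  refine Finset.sum_congr rfl fun i _ => Finset.sum_congr rfl fun j _ =>
    Finset.expect_congr rfl fun a _ => by ring

theorem eq_zero_of_expect_sq_nonpos {f : ι → ℝ} (hf : 𝔼 a, f a ^ 2 ≤ 0) (a : ι) : f a = 0 := by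
  have h0 := le_antisymm hf (Finset.expect_nonneg fun a _ => sq_nonneg (f a))
  have := (Finset.expect_eq_zero_iff_of_nonneg
    (fun a _ => sq_nonneg (f a))).1 h0 a (Finset.mem_univ a)
  exact pow_eq_zero_iff two_ne_zero |>.1 this

/-- A family of real functions that is orthonormal for the uniform average. -/
def IsOrthonormalFamily {κ : Type*} [DecidableEq κ] (h : κ → ι → ℝ) : Prop :=
  ∀ o o', 𝔼 a, h o a * h o' a = if o = o' then 1 else 0

theorem IsOrthonormalFamily.expect_sub_sq {κ : Type*} [DecidableEq κ] {h : κ → ι → ℝ}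
    (hh : IsOrthonormalFamily h) (S : Finset κ) (z : ι → ℝ) (c : κ → ℝ) :
    𝔼 a, (z a - ∑ o ∈ S, c o * h o a) ^ 2 =
      𝔼 a, z a ^ 2 - 2 * ∑ o ∈ S, c o * 𝔼 a, h o a * z a + ∑ o ∈ S, c o ^ 2 := by
  have h1 : ∀ a, (z a - ∑ o ∈ S, c o * h o a) ^ 2 = z a ^ 2 - 2 * ∑ o ∈ S, c o * (h o a * z a) +
      ∑ o ∈ S, ∑ o' ∈ S, c o * c o' * (h o a * h o' a) := by
    intro a
    have : ∑ o ∈ S, ∑ o' ∈ S, c o * c o' * (h o a * h o' a) = (∑ o ∈ S, c o * h o a) ^ 2 := by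
      rw [sq, Finset.sum_mul_sum]
      refine Finset.sum_congr rfl fun i _ => Finset.sum_congr rfl fun j _ => by ring
    have h2 : ∑ o ∈ S, c o * (h o a * z a) = (∑ o ∈ S, c o * h o a) * z a := by
      rw [Finset.sum_mul]; refine Finset.sum_congr rfl fun i _ => by ring
    rw [this, h2]; ring
  simp only [h1, Finset.expect_add_distrib, Finset.expect_sub_distrib, ← Finset.mul_expect,
    Finset.expect_sum_comm]
  congr 1
  refine Finset.sum_congr rfl fun o ho => ?_
  simp only [hh o]
  simp [ho, sq]

theorem IsOrthonormalFamily.expect_sub_proj_sq {κ : Type*} [DecidableEq κ] {h : κ → ι → ℝ}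
    (hh : IsOrthonormalFamily h) (S : Finset κ) (z : ι → ℝ) :
    𝔼 a, (z a - ∑ o ∈ S, (𝔼 b, h o b * z b) * h o a) ^ 2 =
      𝔼 a, z a ^ 2 - ∑ o ∈ S, (𝔼 a, h o a * z a) ^ 2 := by
  rw [hh.expect_sub_sq]
  simp only [sq]; ring

theorem IsOrthonormalFamily.bessel {κ : Type*} [DecidableEq κ] {h : κ → ι → ℝ}
    (hh : IsOrthonormalFamily h) (S : Finset κ) (z : ι → ℝ) :
    ∑ o ∈ S, (𝔼 a, h o a * z a) ^ 2 ≤ 𝔼 a, z a ^ 2 := by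
  have := hh.expect_sub_proj_sq S z
  have h0 := Finset.expect_nonneg (s := Finset.univ) fun a _ =>
    sq_nonneg (z a - ∑ o ∈ S, (𝔼 b, h o b * z b) * h o a)
  linarith

theorem norm_featureMean_sq_of_support {h : ι → ℝ} {Z : ι → EuclideanSpace ℝ (Fin p)}
    {A : Finset (Fin p)} (hA : ∀ i ∉ A, featureMean h Z i = 0) :
    ‖featureMean h Z‖ ^ 2 = ∑ i ∈ A, (𝔼 a, h a * Z a i) ^ 2 := by
  rw [norm_sq_eq_sum]
  refine (Finset.sum_subset (Finset.subset_univ A) fun i _ hi => ?_).symm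
  simp [hA i hi]

/-- Bessel's inequality in each coordinate, summed. The set `A` discards coordinates where no
correlation lives; this is what turns a trace bound into a budget for the features. -/
theorem sum_norm_featureMean_sq_le {κ : Type*} [DecidableEq κ] {h : κ → ι → ℝ}
    (hh : IsOrthonormalFamily h) (S : Finset κ) (Z : ι → EuclideanSpace ℝ (Fin p))
    (A : Finset (Fin p)) (hA : ∀ o ∈ S, ∀ i ∉ A, featureMean (h o) Z i = 0) :
    ∑ o ∈ S, ‖featureMean (h o) Z‖ ^ 2 ≤ ∑ i ∈ A, secondMoment Z i i := by
  rw [Finset.sum_congr rfl fun o ho => norm_featureMean_sq_of_support (hA o ho), Finset.sum_comm]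
  refine Finset.sum_le_sum fun i _ => ?_
  simpa [secondMoment, sq] using hh.bessel S fun a => Z a i

/-- If the second moment matrix is diagonal with the value `l` on the support of the correlation
vector `ζ` of a normalized function `h`, then `‖ζ‖² ≤ l` up to the deviation of `⟪ζ, Z⟫` from
`l h`. -/
theorem expect_inner_sub_sq {h : ι → ℝ} (hh : 𝔼 a, h a * h a = 1)
    {Z : ι → EuclideanSpace ℝ (Fin p)} {w : Fin p → ℝ}
    (hM : ∀ i j, secondMoment Z i j = if i = j then w i else 0) {l : ℝ}
    (hl : ∀ i, featureMean h Z i ≠ 0 → w i = l) :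
    𝔼 a, (inner ℝ (featureMean h Z) (Z a) - l * h a) ^ 2 =
      l * (l - ‖featureMean h Z‖ ^ 2) := by
  have h1 : ∀ a, (inner ℝ (featureMean h Z) (Z a) - l * h a) ^ 2 =
      (inner ℝ (featureMean h Z) (Z a)) ^ 2
        - 2 * l * (h a * inner ℝ (featureMean h Z) (Z a)) + l ^ 2 * (h a * h a) := by
    intro a; ring
  simp only [h1, Finset.expect_add_distrib, Finset.expect_sub_distrib, ← Finset.mul_expect, hh,
    ← inner_featureMean, real_inner_self_eq_norm_sq]
  -- The vector `ζ` is an eigenvector of the second moment matrix for the value `l`, so the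
  -- quadratic form at `ζ` is `l ‖ζ‖²`.
  have h2 : 𝔼 a, (inner ℝ (featureMean h Z) (Z a)) ^ 2 = l * ‖featureMean h Z‖ ^ 2 := by
    rw [expect_inner_sq, norm_sq_eq_sum, Finset.mul_sum]
    refine Finset.sum_congr rfl fun i _ => ?_
    simp only [hM, mul_ite, mul_zero, Finset.sum_ite_eq, Finset.mem_univ, if_true]
    by_cases hi : featureMean h Z i = 0
    · simp [hi]
    · rw [hl i hi]; ring
  rw [h2]; ring

end Moments

/-! ### The contrastive loss as a function of the representation -/

section PairLoss

variable {ι κ : Type*} [Fintype ι] [DecidableEq κ] {p : ℕ}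

/-- The average similarity of the positive pairs. -/
def positiveTerm (g : ι → κ) (Z : ι → EuclideanSpace ℝ (Fin p)) : ℝ :=
  𝔼 a, 𝔼 b with g b = g a, inner ℝ (Z a) (Z b)

/-- The contrastive loss as a function of the representation of the data set. -/
def pairLoss (g : ι → κ) (Z : ι → EuclideanSpace ℝ (Fin p)) : ℝ :=
  -2 * positiveTerm g Z + 𝔼 a, 𝔼 b, (inner ℝ (Z a) (Z b)) ^ 2

/-- The positive partner of a uniform point is itself uniform: a point `b` receives the weight `1 /
|group|` from each of the `|group|` members of its group. -/
theorem expect_expect_group (g : ι → κ) (f : ι → ℝ) :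
    𝔼 a, 𝔼 b with g b = g a, f b = 𝔼 a, f a := by
  rw [Fintype.expect_eq_sum_div_card, Fintype.expect_eq_sum_div_card]
  congr 1
  simp only [Finset.expect_eq_sum_div_card, Finset.sum_div]
  simp only [Finset.sum_filter]
  rw [Finset.sum_comm]
  simp only [← Finset.sum_filter]
  have : ∀ b : ι, ∑ a with g b = g a, f b / ((Finset.univ.filter fun b => g b = g a).card : ℝ)
      = f b := by
    intro b
    have h1 : ∀ a ∈ Finset.univ.filter (fun a => g b = g a),
        f b / ((Finset.univ.filter fun b => g b = g a).card : ℝ) =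
        f b / ((Finset.univ.filter fun a => g b = g a).card : ℝ) := by
      intro a ha
      simp only [Finset.mem_filter, Finset.mem_univ, true_and] at ha
      simp only [← ha, eq_comm]
    rw [Finset.sum_congr rfl h1, Finset.sum_const, nsmul_eq_mul]
    have : ((Finset.univ.filter fun a => g b = g a).card : ℝ) ≠ 0 := by
      have : b ∈ Finset.univ.filter fun a => g b = g a := by simp
      exact_mod_cast (Finset.card_pos.2 ⟨b, this⟩).ne'
    field_simp
  simp only [this]

/-- Arithmetic-geometric mean on each pair, both members of a positive pair being uniform.
Representations that are constant on the groups give equality. -/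
theorem positiveTerm_le (g : ι → κ) (Z : ι → EuclideanSpace ℝ (Fin p)) :
    positiveTerm g Z ≤ ∑ i, secondMoment Z i i := by
  rw [← expect_norm_sq]
  have h1 : positiveTerm g Z ≤
      𝔼 a, 𝔼 b with g b = g a, (‖Z a‖ ^ 2 / 2 + ‖Z b‖ ^ 2 / 2) := by
    refine Finset.expect_le_expect fun a _ => Finset.expect_le_expect fun b _ => ?_
    have := sq_nonneg (‖Z a‖ - ‖Z b‖)
    have := real_inner_le_norm (Z a) (Z b)
    nlinarith
  refine h1.trans_eq ?_
  have h2 : ∀ a, 𝔼 b with g b = g a, ‖Z a‖ ^ 2 / 2 = ‖Z a‖ ^ 2 / 2 := fun a =>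
    Finset.expect_const ⟨a, by simp⟩ _
  simp only [Finset.expect_add_distrib, h2, expect_expect_group g fun b => ‖Z b‖ ^ 2 / 2]
  rw [← Finset.expect_add_distrib]
  simp

theorem positiveTerm_eq (g : ι → κ) (Z : ι → EuclideanSpace ℝ (Fin p))
    (hZ : ∀ a b, g b = g a → Z b = Z a) :
    positiveTerm g Z = ∑ i, secondMoment Z i i := by
  rw [← expect_norm_sq]
  refine Finset.expect_congr rfl fun a _ => ?_
  rw [← Finset.expect_const (s := Finset.univ.filter fun b => g b = g a) ⟨a, by simp⟩ (‖Z a‖ ^ 2)]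
  refine Finset.expect_congr rfl fun b hb => ?_
  rw [hZ a b (by simpa using hb), real_inner_self_eq_norm_sq]

theorem units_mul_cast (u w : ℤˣ) :
    ((u : ℤ) : ℝ) * ((w : ℤ) : ℝ) = if w = u then 1 else -1 := by
  rcases Int.units_eq_one_or u with rfl | rfl <;> rcases Int.units_eq_one_or w with rfl | rfl <;>
    norm_num

/-- For balanced binary labels, the similarity of the positive pairs is carried by the mean of the
representation and by its correlation with the label. -/
theorem positiveTerm_label [Nonempty ι] (y : ι → ℤˣ) (hy : 𝔼 a, ((y a : ℤ) : ℝ) = 0)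
    (Z : ι → EuclideanSpace ℝ (Fin p)) :
    positiveTerm y Z = ‖featureMean (fun _ => 1) Z‖ ^ 2 +
      ‖featureMean (fun a => ((y a : ℤ) : ℝ)) Z‖ ^ 2 := by
  rw [norm_featureMean_sq, norm_featureMean_sq, ← Finset.expect_add_distrib]
  refine Finset.expect_congr rfl fun a _ => ?_
  rw [← Finset.expect_add_distrib]
  have hs : ∀ F : ι → ℝ, ∑ b with y b = y a, F b =
      (∑ b, (1 + ((y a : ℤ) : ℝ) * ((y b : ℤ) : ℝ)) * F b) / 2 := by
    intro F
    rw [Finset.sum_filter, Finset.sum_div]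
    refine Finset.sum_congr rfl fun b _ => ?_
    rw [units_mul_cast]
    split_ifs <;> ring
  have hN : (Fintype.card ι : ℝ) ≠ 0 := by exact_mod_cast Fintype.card_ne_zero
  have hy' : ∑ b, ((y b : ℤ) : ℝ) = 0 := by
    rw [Fintype.expect_eq_sum_div_card, div_eq_zero_iff] at hy
    exact hy.resolve_right hN
  have hc : ((Finset.univ.filter fun b => y b = y a).card : ℝ) = Fintype.card ι / 2 := by
    have := hs fun _ => 1
    simpa [Finset.sum_add_distrib, ← Finset.mul_sum, hy'] using this
  rw [Finset.expect_eq_sum_div_card, hc, hs, Fintype.expect_eq_sum_div_card]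
  have : ∀ b, (1 + ((y a : ℤ) : ℝ) * ((y b : ℤ) : ℝ)) * inner ℝ (Z a) (Z b) =
      1 * 1 * inner ℝ (Z a) (Z b) + ((y a : ℤ) : ℝ) * ((y b : ℤ) : ℝ) * inner ℝ (Z a) (Z b) := by
    intro b; ring
  simp only [this]
  field_simp

end PairLoss

/-! ### Lower bounds for the losses and their equality cases -/

section Optimality

variable {ι κ γ : Type*} [Fintype ι] [DecidableEq κ] [DecidableEq γ] {p : ℕ}

theorem sum_sum_sub_diag_sq (M : Fin p → Fin p → ℝ) (w : Fin p → ℝ) :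
    ∑ i, ∑ j, (M i j - if i = j then w i else 0) ^ 2 =
      ∑ i, ∑ j, M i j ^ 2 - 2 * ∑ i, w i * M i i + ∑ i, w i ^ 2 := by
  rw [Finset.mul_sum, ← Finset.sum_sub_distrib, ← Finset.sum_add_distrib]
  refine Finset.sum_congr rfl fun i _ => ?_
  have : ∀ j, (M i j - if i = j then w i else 0) ^ 2 =
      M i j ^ 2 - (if i = j then 2 * (w i * M i j) - w i ^ 2 else 0) := by
    intro j; split_ifs <;> ring
  simp only [this, Finset.sum_sub_distrib, Finset.sum_ite_eq, Finset.mem_univ, if_true]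
  ring

theorem eq_diag_of_sum_sq_nonpos {M : Fin p → Fin p → ℝ} {w : Fin p → ℝ}
    (h : ∑ i, ∑ j, (M i j - if i = j then w i else 0) ^ 2 ≤ 0) (i j : Fin p) :
    M i j = if i = j then w i else 0 := by
  have h0 := le_antisymm h (Finset.sum_nonneg fun i _ => Finset.sum_nonneg fun j _ => sq_nonneg _)
  rw [Finset.sum_eq_zero_iff_of_nonneg
    (fun i _ => Finset.sum_nonneg fun j _ => sq_nonneg _)] at h0
  have h1 := h0 i (Finset.mem_univ i)
  rw [Finset.sum_eq_zero_iff_of_nonneg (fun j _ => sq_nonneg _)] at h1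
  have h2 := h1 j (Finset.mem_univ j)
  exact sub_eq_zero.1 (pow_eq_zero_iff two_ne_zero |>.1 h2)

/-- For balanced labels the positive term is the average of `⟪Z a, Z b⟫` against the kernel `1 + y a
y b`, whose mean square is `2`; the loss is the completed square. -/
theorem pairLoss_label_eq [Nonempty ι] (y : ι → ℤˣ) (hy : 𝔼 a, ((y a : ℤ) : ℝ) = 0)
    (Z : ι → EuclideanSpace ℝ (Fin p)) :
    pairLoss y Z = 𝔼 a, 𝔼 b,
      (inner ℝ (Z a) (Z b) - (1 + ((y a : ℤ) : ℝ) * ((y b : ℤ) : ℝ))) ^ 2 - 2 := by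
  rw [pairLoss, positiveTerm_label y hy, norm_featureMean_sq, norm_featureMean_sq]
  have hsq : ∀ a, ((y a : ℤ) : ℝ) * ((y a : ℤ) : ℝ) = 1 := fun a => by simp [units_mul_cast]
  have h1 : ∀ a b, (inner ℝ (Z a) (Z b) - (1 + ((y a : ℤ) : ℝ) * ((y b : ℤ) : ℝ))) ^ 2 =
      (inner ℝ (Z a) (Z b)) ^ 2 - 2 * (1 * 1 * inner ℝ (Z a) (Z b))
        - 2 * (((y a : ℤ) : ℝ) * ((y b : ℤ) : ℝ) * inner ℝ (Z a) (Z b))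
        + 2 + 2 * (((y a : ℤ) : ℝ) * ((y b : ℤ) : ℝ)) := by
    intro a b
    linear_combination ((y b : ℤ) : ℝ) * ((y b : ℤ) : ℝ) * hsq a + hsq b
  simp only [h1, Finset.expect_add_distrib, Finset.expect_sub_distrib, ← Finset.mul_expect, hy,
    Fintype.expect_const, mul_zero, Finset.expect_const_zero]
  ring

theorem le_pairLoss_label [Nonempty ι] (y : ι → ℤˣ) (hy : 𝔼 a, ((y a : ℤ) : ℝ) = 0)
    (Z : ι → EuclideanSpace ℝ (Fin p)) : -2 ≤ pairLoss y Z := by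
  rw [pairLoss_label_eq y hy]
  have := Finset.expect_nonneg (s := Finset.univ) fun a (_ : a ∈ Finset.univ) =>
    Finset.expect_nonneg (s := Finset.univ) fun b (_ : b ∈ Finset.univ) =>
      sq_nonneg (inner ℝ (Z a) (Z b) - (1 + ((y a : ℤ) : ℝ) * ((y b : ℤ) : ℝ)))
  linarith

theorem inner_eq_of_pairLoss_label_le [Nonempty ι] (y : ι → ℤˣ)
    (hy : 𝔼 a, ((y a : ℤ) : ℝ) = 0) {Z : ι → EuclideanSpace ℝ (Fin p)}
    (hZ : pairLoss y Z ≤ -2) (a b : ι) :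
    inner ℝ (Z a) (Z b) = 1 + ((y a : ℤ) : ℝ) * ((y b : ℤ) : ℝ) := by
  rw [pairLoss_label_eq y hy] at hZ
  have hnn : ∀ a, 0 ≤ 𝔼 b,
      (inner ℝ (Z a) (Z b) - (1 + ((y a : ℤ) : ℝ) * ((y b : ℤ) : ℝ))) ^ 2 := fun a =>
    Finset.expect_nonneg fun b _ => sq_nonneg _
  have h0 := le_antisymm (by linarith) (Finset.expect_nonneg fun a (_ : a ∈ Finset.univ) => hnn a)
  have h1 := (Finset.expect_eq_zero_iff_of_nonneg (fun a _ => hnn a)).1 h0 a (Finset.mem_univ a)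
  exact sub_eq_zero.1 (eq_zero_of_expect_sq_nonpos h1.le b)

/-- The positive term is at most the trace of the second moment matrix `M`, and `∑ M² - 2 tr M = ‖M
- 1‖² - p`. -/
theorem le_pairLoss (g : ι → γ) (Z : ι → EuclideanSpace ℝ (Fin p)) :
    ∑ i, ∑ j, (secondMoment Z i j - if i = j then 1 else 0) ^ 2 - p ≤ pairLoss g Z := by
  rw [sum_sum_sub_diag_sq _ fun _ => 1, pairLoss, expect_expect_inner_sq]
  have := positiveTerm_le g Z
  simp only [one_mul, one_pow, Finset.sum_const, Finset.card_univ, Fintype.card_fin, nsmul_eq_mul,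
    mul_one]
  linarith

theorem neg_le_pairLoss (g : ι → γ) (Z : ι → EuclideanSpace ℝ (Fin p)) :
    -(p : ℝ) ≤ pairLoss g Z := by
  have := le_pairLoss g Z
  have h0 : 0 ≤ ∑ i, ∑ j, (secondMoment Z i j - if i = j then 1 else 0) ^ 2 :=
    Finset.sum_nonneg fun i _ => Finset.sum_nonneg fun j _ => sq_nonneg _
  linarith

theorem secondMoment_of_pairLoss_le (g : ι → γ) {Z : ι → EuclideanSpace ℝ (Fin p)}
    (hZ : pairLoss g Z ≤ -p) (i j : Fin p) :
    secondMoment Z i j = if i = j then 1 else 0 := by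
  refine eq_diag_of_sum_sq_nonpos (w := fun _ => 1) ?_ i j
  have := le_pairLoss g Z
  linarith

/-- The mean square `l (l - ‖ζ‖²)` of `⟪ζ, Z⟫ - l h` is nonnegative, and vanishes only if `ζ` reads
off `h` exactly. The equality case later supplies the linear classifiers. -/
theorem norm_featureMean_sq_le_of_secondMoment {h : ι → ℝ} (hh : 𝔼 a, h a * h a = 1)
    {Z : ι → EuclideanSpace ℝ (Fin p)} {w : Fin p → ℝ}
    (hM : ∀ i j, secondMoment Z i j = if i = j then w i else 0) {l : ℝ} (hl0 : 0 < l)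
    (hl : ∀ i, featureMean h Z i ≠ 0 → w i = l) :
    ‖featureMean h Z‖ ^ 2 ≤ l ∧ (‖featureMean h Z‖ ^ 2 = l →
      ∀ a, inner ℝ (featureMean h Z) (Z a) = l * h a) := by
  have h1 := expect_inner_sub_sq hh hM hl
  constructor
  · have h0 := Finset.expect_nonneg (s := Finset.univ) fun a (_ : a ∈ Finset.univ) =>
      sq_nonneg (inner ℝ (featureMean h Z) (Z a) - l * h a)
    rw [h1] at h0
    linarith [nonneg_of_mul_nonneg_right h0 hl0]
  · intro ht a
    rw [ht, sub_self, mul_zero] at h1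
    exact sub_eq_zero.1 (eq_zero_of_expect_sq_nonpos h1.le a)

/-- The joint loss as a function of the representation of the data set. -/
def jointPairLoss (β : ℝ) (y : ι → ℤˣ) (g : ι → γ) (Z : ι → EuclideanSpace ℝ (Fin p)) : ℝ :=
  β * pairLoss y Z + (1 - β) * pairLoss g Z

/-- The limiting value of the diagonal of the second moment matrix for the joint loss. -/
def jointWeight (β : ℝ) (A : Finset (Fin p)) (i : Fin p) : ℝ := if i ∈ A then 1 else 1 - β

theorem sum_jointWeight (β : ℝ) (A : Finset (Fin p)) (hA : A.card = 2) (f : ℝ → ℝ) :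
    ∑ i, f (jointWeight β A i) = 2 * f 1 + (p - 2) * f (1 - β) := by
  rw [← Finset.sum_add_sum_compl A]
  rw [Finset.sum_congr rfl (g := fun _ => f 1) fun i hi => by simp [jointWeight, hi],
    Finset.sum_congr (s₁ := Aᶜ) rfl (g := fun _ => f (1 - β)) fun i hi => by
      simp [jointWeight, Finset.mem_compl.1 hi]]
  have h2 : 2 ≤ p := by
    have := Finset.card_le_univ A
    simpa [hA] using this
  simp only [Finset.sum_const, Finset.card_compl, hA, Fintype.card_fin, nsmul_eq_mul]
  push_cast [Nat.cast_sub h2]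
  ring

/-- The supervised part rewards `‖ζ_n‖² + ‖ζ_c‖²`, which on the support `A` is the trace over `A`
minus the part of those coordinates outside the span of the constant and the label. Adding the trace
bound for the other part, the linear term is at most `2 ∑ w_i M_ii` with `w = 1` on `A` and `1 - β`
elsewhere, and the square is completed around `diag w`. -/
theorem le_jointPairLoss [Nonempty ι] {h : κ → ι → ℝ} (hh : IsOrthonormalFamily h) {n c : κ}
    (hnc : n ≠ c) (hn : ∀ a, h n a = 1) {y : ι → ℤˣ} (hc : ∀ a, h c a = ((y a : ℤ) : ℝ))
    (g : ι → γ) {β : ℝ} (hβ1 : β < 1)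
    (Z : ι → EuclideanSpace ℝ (Fin p)) (A : Finset (Fin p)) (hA : A.card = 2)
    (hAn : ∀ i ∉ A, featureMean (h n) Z i = 0) (hAc : ∀ i ∉ A, featureMean (h c) Z i = 0) :
    ∑ i, ∑ j, (secondMoment Z i j - if i = j then jointWeight β A i else 0) ^ 2 +
      2 * β * ∑ i ∈ A, 𝔼 a, (Z a i - ∑ o ∈ {n, c}, (𝔼 b, h o b * Z b i) * h o a) ^ 2
      - (2 + (p - 2) * (1 - β) ^ 2) ≤ jointPairLoss β y g Z := by
  have hy : 𝔼 a, ((y a : ℤ) : ℝ) = 0 := by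
    have := hh n c
    simpa [hn, hc, hnc] using this
  have hn' : featureMean (h n) Z = featureMean (fun _ => 1) Z := by
    congr 1; funext a; exact hn a
  have hc' : featureMean (h c) Z = featureMean (fun a => ((y a : ℤ) : ℝ)) Z := by
    congr 1; funext a; exact hc a
  have hpos := positiveTerm_le g Z
  rw [jointPairLoss, pairLoss, pairLoss, positiveTerm_label y hy, ← hn', ← hc',
    sum_sum_sub_diag_sq, expect_expect_inner_sq, sum_jointWeight β A hA fun x => x ^ 2]
  simp only [hh.expect_sub_proj_sq]
  have hw : ∑ i, jointWeight β A i * secondMoment Z i i =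
      (1 - β) * ∑ i, secondMoment Z i i + β * ∑ i ∈ A, secondMoment Z i i := by
    have hAs : ∑ i ∈ A, secondMoment Z i i = ∑ i, if i ∈ A then secondMoment Z i i else 0 := by
      rw [Finset.sum_ite_mem, Finset.univ_inter]
    rw [hAs, Finset.mul_sum, Finset.mul_sum, ← Finset.sum_add_distrib]
    refine Finset.sum_congr rfl fun i _ => ?_
    rw [jointWeight]; split_ifs <;> ring
  rw [hw, norm_featureMean_sq_of_support hAn, norm_featureMean_sq_of_support hAc]
  simp only [Finset.sum_pair hnc, Finset.sum_sub_distrib, Finset.sum_add_distrib]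
  have hm : ∀ i, 𝔼 a, Z a i ^ 2 = secondMoment Z i i := fun i => by simp only [secondMoment, sq]
  simp only [hm]
  nlinarith

/-- The optimality conditions of the joint loss, in terms of the correlations of the
representation with an orthonormal family that contains the constant `h n` and the label `h c`. -/
structure IsJointOptimal (h : κ → ι → ℝ) (n c : κ) (β : ℝ)
    (Z : ι → EuclideanSpace ℝ (Fin p)) : Prop where
  expect_norm_sq : 𝔼 a, ‖Z a‖ ^ 2 = 2 + (p - 2) * (1 - β)
  norm_const : ‖featureMean (h n) Z‖ ^ 2 = 1
  norm_label : ‖featureMean (h c) Z‖ ^ 2 = 1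
  inner_label : ∀ a, inner ℝ (featureMean (h c) Z) (Z a) = h c a
  norm_le : ∀ o, o ≠ n → o ≠ c → ‖featureMean (h o) Z‖ ^ 2 ≤ 1 - β
  inner_of_norm_eq : ∀ o, o ≠ n → o ≠ c → ‖featureMean (h o) Z‖ ^ 2 = 1 - β →
    ∀ a, inner ℝ (featureMean (h o) Z) (Z a) = (1 - β) * h o a
  sum_le : ∀ S : Finset κ, n ∉ S → c ∉ S →
    ∑ o ∈ S, ‖featureMean (h o) Z‖ ^ 2 ≤ (1 - β) * (p - 2)

/-- Both nonnegative terms of `le_jointPairLoss` must vanish: `M` is `diag w`, and the coordinates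
in `A` are combinations of the constant and the label. The correlation with any other feature
therefore lives off `A`, where the weight is `1 - β`. -/
theorem isJointOptimal_of_support [Nonempty ι] {h : κ → ι → ℝ} (hh : IsOrthonormalFamily h)
    {n c : κ} (hnc : n ≠ c) (hn : ∀ a, h n a = 1) {y : ι → ℤˣ}
    (hc : ∀ a, h c a = ((y a : ℤ) : ℝ))
    (g : ι → γ) {β : ℝ} (hβ0 : 0 < β) (hβ1 : β < 1)
    {Z : ι → EuclideanSpace ℝ (Fin p)} (A : Finset (Fin p)) (hA : A.card = 2)
    (hAn : ∀ i ∉ A, featureMean (h n) Z i = 0) (hAc : ∀ i ∉ A, featureMean (h c) Z i = 0)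
    (hZ : jointPairLoss β y g Z ≤ -(2 + (p - 2) * (1 - β) ^ 2)) :
    IsJointOptimal h n c β Z := by
  have hle := le_jointPairLoss hh hnc hn hc g hβ1 Z A hA hAn hAc
  have hnn1 : ∀ i ∈ A, 0 ≤ 𝔼 a, (Z a i - ∑ o ∈ {n, c}, (𝔼 b, h o b * Z b i) * h o a) ^ 2 :=
    fun i _ => Finset.expect_nonneg fun a _ => sq_nonneg _
  have hnn2 : 0 ≤ ∑ i, ∑ j, (secondMoment Z i j - if i = j then jointWeight β A i else 0) ^ 2 :=
    Finset.sum_nonneg fun i _ => Finset.sum_nonneg fun j _ => sq_nonneg _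
  have hnn3 := Finset.sum_nonneg hnn1
  have hM : ∀ i j, secondMoment Z i j = if i = j then jointWeight β A i else 0 :=
    eq_diag_of_sum_sq_nonpos (by nlinarith)
  have hres0 : ∑ i ∈ A, 𝔼 a, (Z a i - ∑ o ∈ {n, c}, (𝔼 b, h o b * Z b i) * h o a) ^ 2 = 0 := by
    nlinarith
  have hres : ∀ i ∈ A, ∀ a, Z a i - ∑ o ∈ {n, c}, (𝔼 b, h o b * Z b i) * h o a = 0 :=
    fun i hi => eq_zero_of_expect_sq_nonpos
        ((Finset.sum_eq_zero_iff_of_nonneg hnn1).1 hres0 i hi).le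
  have hone : ∀ o, 𝔼 a, h o a * h o a = 1 := fun o => by simpa using hh o o
  have hwA : ∀ o, (∀ i ∉ A, featureMean (h o) Z i = 0) →
      ∀ i, featureMean (h o) Z i ≠ 0 → jointWeight β A i = 1 := by
    intro o ho i hi
    have : i ∈ A := by by_contra hiA; exact hi (ho i hiA)
    simp [jointWeight, this]
  have hzero : ∀ o, o ≠ n → o ≠ c → ∀ i ∈ A, featureMean (h o) Z i = 0 := by
    intro o hon hoc i hi
    have h1 : ∀ a, Z a i = (𝔼 b, h n b * Z b i) * h n a + (𝔼 b, h c b * Z b i) * h c a := by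
      intro a
      have := hres i hi a
      rw [Finset.sum_pair hnc] at this
      linarith
    rw [featureMean_apply]
    rw [Finset.expect_congr rfl (g := fun a => (𝔼 b, h n b * Z b i) * (h o a * h n a) +
      (𝔼 b, h c b * Z b i) * (h o a * h c a)) fun a _ => by
        rw [show h o a * Z a i = h o a * ((𝔼 b, h n b * Z b i) * h n a +
          (𝔼 b, h c b * Z b i) * h c a) by rw [← h1 a]]; ring]
    rw [Finset.expect_add_distrib, ← Finset.mul_expect, ← Finset.mul_expect, hh o n, hh o c]
    simp [hon, hoc]
  have hwAc : ∀ o, o ≠ n → o ≠ c →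
      ∀ i, featureMean (h o) Z i ≠ 0 → jointWeight β A i = 1 - β := by
    intro o hon hoc i hi
    have : i ∉ A := fun hiA => hi (hzero o hon hoc i hiA)
    simp [jointWeight, this]
  have hn1 := norm_featureMean_sq_le_of_secondMoment (hone n) hM one_pos (hwA n hAn)
  have hc1 := norm_featureMean_sq_le_of_secondMoment (hone c) hM one_pos (hwA c hAc)
  -- The trace over `A` is `2` and is carried entirely by these two correlations; as each is at most
  -- `1`, both equal `1`.
  have hsum : ‖featureMean (h n) Z‖ ^ 2 + ‖featureMean (h c) Z‖ ^ 2 = 2 := by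
    rw [norm_featureMean_sq_of_support hAn, norm_featureMean_sq_of_support hAc]
    simp only [hh.expect_sub_proj_sq] at hres0
    simp only [Finset.sum_pair hnc] at hres0
    have hm : ∀ i ∈ A, 𝔼 a, Z a i ^ 2 = 1 := fun i hi => by
      have := hM i i
      simpa [secondMoment, jointWeight, hi, ← sq] using this
    rw [Finset.sum_sub_distrib, Finset.sum_congr rfl hm, Finset.sum_add_distrib] at hres0
    simp only [Finset.sum_const, hA, nsmul_eq_mul] at hres0
    push_cast at hres0
    linarith
  have hc2 : ‖featureMean (h c) Z‖ ^ 2 = 1 := by linarith [hn1.1, hc1.1]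
  refine ⟨?_, by linarith [hn1.1, hc1.1], hc2, ?_, ?_, ?_, ?_⟩
  · rw [expect_norm_sq]
    simp only [hM, if_true]
    simpa using sum_jointWeight β A hA fun x => x
  · simpa using hc1.2 hc2
  · intro o hon hoc
    exact (norm_featureMean_sq_le_of_secondMoment (hone o) hM (by linarith) (hwAc o hon hoc)).1
  · intro o hon hoc
    exact (norm_featureMean_sq_le_of_secondMoment (hone o) hM (by linarith) (hwAc o hon hoc)).2
  · intro S hnS hcS
    refine (sum_norm_featureMean_sq_le hh S Z Aᶜ fun o ho i hi => hzero o ?_ ?_ i ?_).trans_eq ?_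
    · rintro rfl; exact hnS ho
    · rintro rfl; exact hcS ho
    · simpa using hi
    · simp only [hM, if_true]
      have h1 := sum_jointWeight β A hA fun x => x
      rw [← Finset.sum_add_sum_compl A] at h1
      have h2 : ∑ i ∈ A, jointWeight β A i = 2 := by
        rw [Finset.sum_congr rfl (g := fun _ => 1) fun i hi => by simp [jointWeight, hi]]
        simp [hA]
      linarith

theorem featureMean_map (U : EuclideanSpace ℝ (Fin p) ≃ₗᵢ[ℝ] EuclideanSpace ℝ (Fin p))
    (h : ι → ℝ) (Z : ι → EuclideanSpace ℝ (Fin p)) :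
    featureMean h (fun a => U (Z a)) = U (featureMean h Z) := by
  refine ext_inner_left ℝ fun x => ?_
  obtain ⟨x, rfl⟩ := U.surjective x
  rw [inner_featureMean, U.inner_map_map, inner_featureMean]
  simp only [U.inner_map_map]

theorem pairLoss_map (U : EuclideanSpace ℝ (Fin p) ≃ₗᵢ[ℝ] EuclideanSpace ℝ (Fin p))
    (g : ι → γ) (Z : ι → EuclideanSpace ℝ (Fin p)) :
    pairLoss g (fun a => U (Z a)) = pairLoss g Z := by
  simp only [pairLoss, positiveTerm, U.inner_map_map]

/-- Gram-Schmidt started at `x, y` gives an orthonormal basis in which both vectors use only the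
first two coordinates. The losses and all the conclusions are rotation invariant, so the support
hypothesis costs nothing. -/
theorem exists_rotation_support (hp : 2 ≤ p) (x y : EuclideanSpace ℝ (Fin p)) :
    ∃ (U : EuclideanSpace ℝ (Fin p) ≃ₗᵢ[ℝ] EuclideanSpace ℝ (Fin p)) (A : Finset (Fin p)),
      A.card = 2 ∧ (∀ i ∉ A, U x i = 0) ∧ ∀ i ∉ A, U y i = 0 := by
  let i0 : Fin p := ⟨0, by omega⟩
  let i1 : Fin p := ⟨1, by omega⟩
  have h01 : i0 ≠ i1 := by simp [i0, i1]
  let f : Fin p → EuclideanSpace ℝ (Fin p) := fun i => if i = i0 then x else if i = i1 then y else 0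
  have hf : Module.finrank ℝ (EuclideanSpace ℝ (Fin p)) = Fintype.card (Fin p) := by simp
  let e := InnerProductSpace.gramSchmidtOrthonormalBasis hf f
  have key : ∀ i j : Fin p, i < j → e.repr (f i) j = 0 := by
    intro i j hij
    exact InnerProductSpace.gramSchmidtOrthonormalBasis_inv_triangular' hf f hij
  refine ⟨e.repr, {i0, i1}, Finset.card_pair h01, fun i hi => ?_, fun i hi => ?_⟩
  · simp only [Finset.mem_insert, Finset.mem_singleton, not_or] at hi
    have h1 : i0 < i := lt_of_le_of_ne (by simp [i0, Fin.le_def]) (Ne.symm hi.1)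
    simpa [f] using key i0 i h1
  · simp only [Finset.mem_insert, Finset.mem_singleton, not_or] at hi
    have h1 : i1 < i := by
      have h0 : (i : ℕ) ≠ 0 := fun h => hi.1 (Fin.ext h)
      have h2 : (i : ℕ) ≠ 1 := fun h => hi.2 (Fin.ext h)
      simp only [i1, Fin.lt_def]; omega
    simpa [f, h01.symm] using key i1 i h1

theorem IsJointOptimal.of_map {δ : Type*} {h : δ → ι → ℝ} {n c : δ} {β : ℝ}
    {Z : ι → EuclideanSpace ℝ (Fin p)}
    (U : EuclideanSpace ℝ (Fin p) ≃ₗᵢ[ℝ] EuclideanSpace ℝ (Fin p))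
    (hZ : IsJointOptimal h n c β fun a => U (Z a)) : IsJointOptimal h n c β Z := by
  obtain ⟨h1, h2, h3, h4, h5, h6, h7⟩ := hZ
  simp only [featureMean_map, U.norm_map, U.inner_map_map] at h1 h2 h3 h4 h5 h6 h7
  exact ⟨h1, h2, h3, h4, h5, h6, h7⟩

theorem neg_le_jointPairLoss [Nonempty ι] {h : κ → ι → ℝ} (hh : IsOrthonormalFamily h)
    {n c : κ} (hnc : n ≠ c) (hn : ∀ a, h n a = 1) {y : ι → ℤˣ}
    (hc : ∀ a, h c a = ((y a : ℤ) : ℝ))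
    (g : ι → γ) {β : ℝ} (hβ0 : 0 < β) (hβ1 : β < 1) (hp : 2 ≤ p)
    (Z : ι → EuclideanSpace ℝ (Fin p)) :
    -(2 + (p - 2) * (1 - β) ^ 2) ≤ jointPairLoss β y g Z := by
  obtain ⟨U, A, hA, hx, hy⟩ :=
    exists_rotation_support hp (featureMean (h n) Z) (featureMean (h c) Z)
  rw [← featureMean_map] at hx hy
  have hle := le_jointPairLoss hh hnc hn hc g hβ1 (fun a => U (Z a)) A hA hx hy
  simp only [jointPairLoss, pairLoss_map] at hle ⊢
  refine le_trans ?_ hle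
  have h1 : 0 ≤ ∑ i, ∑ j, (secondMoment (fun a => U (Z a)) i j -
      if i = j then jointWeight β A i else 0) ^ 2 :=
    Finset.sum_nonneg fun i _ => Finset.sum_nonneg fun j _ => sq_nonneg _
  have h2 : 0 ≤ ∑ i ∈ A, 𝔼 a, (U (Z a) i - ∑ o ∈ {n, c}, (𝔼 b, h o b * U (Z b) i) * h o a) ^ 2 :=
    Finset.sum_nonneg fun i _ => Finset.expect_nonneg fun a _ => sq_nonneg _
  nlinarith [mul_nonneg hβ0.le h2]

theorem isJointOptimal_of_le [Nonempty ι] {h : κ → ι → ℝ} (hh : IsOrthonormalFamily h)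
    {n c : κ} (hnc : n ≠ c) (hn : ∀ a, h n a = 1) {y : ι → ℤˣ}
    (hc : ∀ a, h c a = ((y a : ℤ) : ℝ))
    (g : ι → γ) {β : ℝ} (hβ0 : 0 < β) (hβ1 : β < 1) (hp : 2 ≤ p)
    {Z : ι → EuclideanSpace ℝ (Fin p)}
    (hZ : jointPairLoss β y g Z ≤ -(2 + (p - 2) * (1 - β) ^ 2)) :
    IsJointOptimal h n c β Z := by
  obtain ⟨U, A, hA, hx, hy⟩ :=
    exists_rotation_support hp (featureMean (h n) Z) (featureMean (h c) Z)
  rw [← featureMean_map] at hx hy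
  refine IsJointOptimal.of_map U
    (isJointOptimal_of_support hh hnc hn hc g hβ0 hβ1 A hA hx hy ?_)
  simpa only [jointPairLoss, pairLoss_map] using hZ

end Optimality

/-! ### Models in the coordinates of the feature basis -/

section Parameters

variable {K q d p : ℕ} (v : OrthonormalBasis (Fin K ⊕ Fin q) ℝ (EuclideanSpace ℝ (Fin d)))
  (φ : Fin K → ℝ) (σ : ℝ)

/-- The scale of a feature, the bias being a feature of scale one. -/
def featureScale : Option (Fin K) → ℝ
  | none => 1
  | some k => φ k

/-- The sign of a feature, the bias being a feature of constant sign. -/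
def featureSign (τ : Fin K → ℤˣ) : Option (Fin K) → ℝ
  | none => 1
  | some k => ((τ k : ℤ) : ℝ)

theorem featureScale_sq (o : Option (Fin K)) : featureScale φ o ^ 2 = varianceTuple φ o := by
  cases o <;> simp [featureScale, varianceTuple]

/-- The weights of a model along the features, the bias being the weight of the constant. -/
def featureWeight (Θ : Params p d) : Option (Fin K) → EuclideanSpace ℝ (Fin p)
  | none => WithLp.toLp 2 Θ.2
  | some k => WithLp.toLp 2 (Θ.1 *ᵥ (v (Sum.inl k)).ofLp)

/-- The weights of a model along the noise directions. -/
def noiseWeight (Θ : Params p d) (j : Fin q) : EuclideanSpace ℝ (Fin p) :=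
  WithLp.toLp 2 (Θ.1 *ᵥ (v (Sum.inr j)).ofLp)

theorem alignment_eq (Θ : Params p d) (k : Fin K) :
    alignment Θ (v (Sum.inl k)) = ‖featureWeight v Θ (some k)‖ := rfl

theorem model_dataPoint (Θ : Params p d) (τ : Fin K → ℤˣ) (ξ : NoiseDraw q) :
    model Θ (dataPoint v φ σ τ ξ) =
      ∑ o, (featureScale φ o * featureSign τ o) • featureWeight v Θ o +
        (σ * ((ξ.2 : ℤ) : ℝ)) • noiseWeight v Θ ξ.1 := by
  rw [Fintype.sum_option]
  simp only [model, dataPoint, featureScale, featureSign, featureWeight, noiseWeight,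
    WithLp.ofLp_add, WithLp.ofLp_sum, WithLp.ofLp_smul, Matrix.mulVec_add, Matrix.mulVec_sum,
    Matrix.mulVec_smul, mul_one, one_smul]
  ext i
  simp
  ring

/-- Parseval for each row of `W` in the basis `v`. -/
theorem frobeniusNorm_sq (Θ : Params p d) :
    frobeniusNorm Θ ^ 2 = ∑ o, ‖featureWeight v Θ o‖ ^ 2 + ∑ j, ‖noiseWeight v Θ j‖ ^ 2 := by
  rw [frobeniusNorm, Real.sq_sqrt (by positivity)]
  have hrow : ∀ i, ∑ j, Θ.1 i j ^ 2 = ∑ b, (Θ.1 *ᵥ (v b).ofLp) i ^ 2 := by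
    intro i
    have h1 := v.sum_sq_norm_inner_right (WithLp.toLp 2 (Θ.1 i))
    rw [norm_sq_eq_sum] at h1
    rw [← h1]
    refine Finset.sum_congr rfl fun b _ => ?_
    rw [Real.norm_eq_abs, sq_abs, real_inner_comm, inner_eq_sum]
    rfl
  simp only [hrow, Fintype.sum_option, norm_sq_eq_sum, featureWeight, noiseWeight]
  rw [Finset.sum_comm, Fintype.sum_sum_type]
  ring

theorem exists_params (α : Option (Fin K) → EuclideanSpace ℝ (Fin p))
    (w : Fin q → EuclideanSpace ℝ (Fin p)) :
    ∃ Θ : Params p d, featureWeight v Θ = α ∧ noiseWeight v Θ = w := by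
  let γ : Fin K ⊕ Fin q → EuclideanSpace ℝ (Fin p) := Sum.elim (fun k => α (some k)) w
  have key : ∀ b, (Matrix.of fun i j => ∑ b, γ b i * v b j) *ᵥ (v b).ofLp = (γ b).ofLp := by
    intro b
    ext i
    have h1 : ∀ b', ∑ j, v b' j * v b j = if b' = b then 1 else 0 := by
      intro b'
      rw [← inner_eq_sum, v.inner_eq_ite]
    simp only [Matrix.mulVec, dotProduct, Matrix.of_apply, Finset.sum_mul]
    rw [Finset.sum_comm]
    simp only [mul_assoc, ← Finset.mul_sum, h1]
    simp
  refine ⟨(Matrix.of fun i j => ∑ b, γ b i * v b j, (α none).ofLp), ?_, ?_⟩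
  · funext o
    cases o with
    | none => rfl
    | some k => simp only [featureWeight, key]; rfl
  · funext j
    simp only [noiseWeight, key]; rfl

end Parameters

/-! ### The shortest model with a given representation -/

section Interpolation

variable {ι : Type*} [Fintype ι] {K q d p : ℕ}
  (v : OrthonormalBasis (Fin K ⊕ Fin q) ℝ (EuclideanSpace ℝ (Fin d)))
  (φ : Fin K → ℝ) (σ : ℝ) (τ : ι → Fin K → ℤˣ) (ω : ι → NoiseDraw q)

/-- The data set with feature signs `τ` and noise draws `ω`. -/
def dataSet (a : ι) : EuclideanSpace ℝ (Fin d) := dataPoint v φ σ (τ a) (ω a)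

/-- The representation of the data set. -/
def representation (Θ : Params p d) (a : ι) : EuclideanSpace ℝ (Fin p) :=
  model Θ (dataSet v φ σ τ ω a)

/-- The sign of a feature as a function of the data point. -/
def signs (o : Option (Fin K)) (a : ι) : ℝ := featureSign (τ a) o

/-- The ratio between the feature weight of the shortest interpolating model and the correlation
of the representation with the feature. -/
def gain (N : ℝ) (o : Option (Fin K)) : ℝ :=
  N * featureScale φ o / (σ ^ 2 + N * varianceTuple φ o)

/-- The saving in squared norm due to a feature of variance `l`. -/
def saving (N l : ℝ) : ℝ := N ^ 2 * l / (σ ^ 2 * (σ ^ 2 + N * l))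

/-- The squared norm of the shortest model with a given representation of the data set. -/
def interpolationCost (Z : ι → EuclideanSpace ℝ (Fin p)) : ℝ :=
  Fintype.card ι / σ ^ 2 * 𝔼 a, ‖Z a‖ ^ 2 -
    ∑ o, saving σ (Fintype.card ι) (varianceTuple φ o) * ‖featureMean (signs τ o) Z‖ ^ 2

variable {v φ σ τ ω}

theorem varianceTuple_nonneg (o : Option (Fin K)) : 0 ≤ varianceTuple φ o := by
  rw [← featureScale_sq]; positivity

theorem saving_lt_saving (hσ : 0 < σ) {N : ℝ} (hN : 0 < N) {l l' : ℝ} (hl : 0 ≤ l)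
    (h : l < l') : saving σ N l < saving σ N l' := by
  have h' : 0 < l' := hl.trans_lt h
  rw [saving, saving, div_lt_div_iff₀ (by positivity) (by positivity)]
  -- This is exactly the difference of the two cross products.
  have : 0 < N ^ 2 * σ ^ 4 * (l' - l) := by
    have := sub_pos.2 h
    positivity
  nlinarith

theorem saving_le_saving (hσ : 0 < σ) {N : ℝ} (hN : 0 < N) {l l' : ℝ} (hl : 0 ≤ l)
    (h : l ≤ l') : saving σ N l ≤ saving σ N l' := by
  rcases h.eq_or_lt with rfl | h
  · rfl
  · exact (saving_lt_saving hσ hN hl h).le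

theorem saving_nonneg {N : ℝ} (hN : 0 ≤ N) {l : ℝ} (hl : 0 ≤ l) : 0 ≤ saving σ N l := by
  unfold saving; positivity

theorem expect_norm_sub_sq (hh : IsOrthonormalFamily (signs τ))
    (Z : ι → EuclideanSpace ℝ (Fin p)) (α : Option (Fin K) → EuclideanSpace ℝ (Fin p)) :
    𝔼 a, ‖Z a - ∑ o, (featureScale φ o * signs τ o a) • α o‖ ^ 2 =
      𝔼 a, ‖Z a‖ ^ 2 - 2 * ∑ o, featureScale φ o * inner ℝ (α o) (featureMean (signs τ o) Z) +
        ∑ o, featureScale φ o ^ 2 * ‖α o‖ ^ 2 := by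
  have h1 : ∀ i, 𝔼 a, (Z a i - ∑ o, (featureScale φ o * α o i) * signs τ o a) ^ 2 = _ := fun i =>
    hh.expect_sub_sq Finset.univ (fun a => Z a i) fun o => featureScale φ o * α o i
  have h2 : ∀ a, ‖Z a - ∑ o, (featureScale φ o * signs τ o a) • α o‖ ^ 2 =
      ∑ i, (Z a i - ∑ o, (featureScale φ o * α o i) * signs τ o a) ^ 2 := by
    intro a
    rw [norm_sq_eq_sum]
    refine Finset.sum_congr rfl fun i _ => ?_
    simp only [PiLp.sub_apply, WithLp.ofLp_sum, Finset.sum_apply, PiLp.smul_apply, smul_eq_mul]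
    congr 2
    refine Finset.sum_congr rfl fun o _ => by ring
  simp only [h2, Finset.expect_sum_comm, h1, Finset.sum_add_distrib, Finset.sum_sub_distrib,
    norm_sq_eq_sum, inner_eq_sum, ← featureMean_apply, ← Finset.mul_sum]
  rw [Finset.sum_comm (s := Finset.univ (α := Fin p)),
      Finset.sum_comm (s := Finset.univ (α := Fin p))]
  simp only [Finset.mul_sum, mul_assoc, mul_pow]

/-- Given the representation, the feature weights determine the noise weight on every used
direction, as the residual of the point owning it divided by `±σ`. The norm thus becomes a ridge
regression, which orthonormality of the signs splits into one quadratic per feature; each is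
completed to a square. -/
theorem frobeniusNorm_sq_eq [Nonempty ι] (hσ : 0 < σ) (hω : Function.Injective fun a => (ω a).1)
    (hh : IsOrthonormalFamily (signs τ)) (Θ : Params p d) :
    frobeniusNorm Θ ^ 2 = interpolationCost φ σ τ (representation v φ σ τ ω Θ) +
      ∑ o, (1 + Fintype.card ι * varianceTuple φ o / σ ^ 2) * ‖featureWeight v Θ o -
        gain φ σ (Fintype.card ι) o •
          featureMean (signs τ o) (representation v φ σ τ ω Θ)‖ ^ 2 +
      ∑ j ∈ (Finset.univ.image fun a => (ω a).1)ᶜ, ‖noiseWeight v Θ j‖ ^ 2 := by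
  set Z := representation v φ σ τ ω Θ with hZ
  set N : ℝ := (Fintype.card ι : ℝ) with hN
  have hN0 : 0 < N := by rw [hN]; exact_mod_cast Fintype.card_pos
  have h1 : ∀ a, ‖noiseWeight v Θ (ω a).1‖ ^ 2 =
      ‖Z a - ∑ o, (featureScale φ o * signs τ o a) • featureWeight v Θ o‖ ^ 2 / σ ^ 2 := by
    intro a
    have : Z a - ∑ o, (featureScale φ o * signs τ o a) • featureWeight v Θ o =
        (σ * (((ω a).2 : ℤ) : ℝ)) • noiseWeight v Θ (ω a).1 := by
      rw [hZ, representation, dataSet, model_dataPoint]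
      simp only [signs]
      abel
    rw [this, norm_smul, mul_pow, Real.norm_eq_abs, sq_abs, mul_pow]
    have : (((ω a).2 : ℤ) : ℝ) ^ 2 = 1 := by rw [sq, units_mul_cast, if_pos rfl]
    rw [this]; field_simp
  have h2 : ∑ a, ‖noiseWeight v Θ (ω a).1‖ ^ 2 = N / σ ^ 2 *
      𝔼 a, ‖Z a - ∑ o, (featureScale φ o * signs τ o a) • featureWeight v Θ o‖ ^ 2 := by
    rw [Fintype.expect_eq_sum_div_card, ← hN]
    simp only [h1, ← Finset.sum_div]
    field_simp
  rw [frobeniusNorm_sq v, ← Finset.sum_add_sum_compl (Finset.univ.image fun a => (ω a).1)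
    (fun j => ‖noiseWeight v Θ j‖ ^ 2), Finset.sum_image (fun a _ b _ h => hω h), h2,
    expect_norm_sub_sq hh, interpolationCost, ← hN]
  have h3 : ∀ o, (1 + N * varianceTuple φ o / σ ^ 2) *
      ‖featureWeight v Θ o - gain φ σ N o • featureMean (signs τ o) Z‖ ^ 2 =
      ‖featureWeight v Θ o‖ ^ 2
        - N / σ ^ 2 * 2 *
          (featureScale φ o * inner ℝ (featureWeight v Θ o) (featureMean (signs τ o) Z))
        + N / σ ^ 2 * (featureScale φ o ^ 2 * ‖featureWeight v Θ o‖ ^ 2)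
        + saving σ N (varianceTuple φ o) * ‖featureMean (signs τ o) Z‖ ^ 2 := by
    intro o
    have hl : 0 ≤ varianceTuple φ o := varianceTuple_nonneg o
    rw [norm_sub_sq_real, inner_smul_right, norm_smul, mul_pow, Real.norm_eq_abs, sq_abs, gain,
      saving, div_pow, mul_pow, featureScale_sq]
    have h0 : σ ^ 2 + N * varianceTuple φ o ≠ 0 := by positivity
    field_simp
    ring
  simp only [h3, Finset.sum_add_distrib, Finset.sum_sub_distrib, ← Finset.mul_sum]
  ring

theorem exists_interpolation [Nonempty ι] (hσ : 0 < σ)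
    (hω : Function.Injective fun a => (ω a).1) (hh : IsOrthonormalFamily (signs τ))
    (Z : ι → EuclideanSpace ℝ (Fin p)) :
    ∃ Θ : Params p d, representation v φ σ τ ω Θ = Z ∧
      frobeniusNorm Θ ^ 2 = interpolationCost φ σ τ Z ∧
      ∀ o, featureWeight v Θ o = gain φ σ (Fintype.card ι) o • featureMean (signs τ o) Z := by
  let α : Option (Fin K) → EuclideanSpace ℝ (Fin p) := fun o =>
    gain φ σ (Fintype.card ι) o • featureMean (signs τ o) Z
  -- Each used direction stores the residual of its point; a sign is its own inverse. Unused
  -- directions take the default `0` and add nothing to the norm.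
  let w : Fin q → EuclideanSpace ℝ (Fin p) := Function.extend (fun a => (ω a).1)
    (fun a => ((((ω a).2 : ℤ) : ℝ) / σ) •
      (Z a - ∑ o, (featureScale φ o * signs τ o a) • α o)) 0
  obtain ⟨Θ, h1, h2⟩ := exists_params v α w
  have hZ : representation v φ σ τ ω Θ = Z := by
    funext a
    have hw : w (ω a).1 = ((((ω a).2 : ℤ) : ℝ) / σ) •
      (Z a - ∑ o, (featureScale φ o * signs τ o a) • α o) := hω.extend_apply _ _ a
    rw [representation, dataSet, model_dataPoint, h1, h2, hw, smul_smul]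
    have : σ * (((ω a).2 : ℤ) : ℝ) * ((((ω a).2 : ℤ) : ℝ) / σ) = 1 := by
      have : (((ω a).2 : ℤ) : ℝ) * (((ω a).2 : ℤ) : ℝ) = 1 := by rw [units_mul_cast, if_pos rfl]
      field_simp
      rw [sq, this]
    rw [this, one_smul]
    simp only [signs]
    abel
  refine ⟨Θ, hZ, ?_, fun o => by rw [h1]⟩
  rw [frobeniusNorm_sq_eq hσ hω hh, hZ, h1, h2]
  have h3 : ∀ j ∈ (Finset.univ.image fun a => (ω a).1)ᶜ, ‖w j‖ ^ 2 = 0 := by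
    intro j hj
    have : w j = 0 := Function.extend_apply' _ _ _ fun ⟨a, ha⟩ => by simp [← ha] at hj
    simp [this]
  rw [Finset.sum_eq_zero h3]
  simp [α]

theorem interpolationCost_le [Nonempty ι] (hσ : 0 < σ)
    (hω : Function.Injective fun a => (ω a).1)
    (hh : IsOrthonormalFamily (signs τ)) (Θ : Params p d) :
    interpolationCost φ σ τ (representation v φ σ τ ω Θ) ≤ frobeniusNorm Θ ^ 2 ∧
    (frobeniusNorm Θ ^ 2 ≤ interpolationCost φ σ τ (representation v φ σ τ ω Θ) →
      (∀ o, featureWeight v Θ o = gain φ σ (Fintype.card ι) o •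
        featureMean (signs τ o) (representation v φ σ τ ω Θ)) ∧
      ∀ j, (∀ a, (ω a).1 ≠ j) → noiseWeight v Θ j = 0) := by
  rw [frobeniusNorm_sq_eq hσ hω hh]
  have hpos : ∀ o, 0 < 1 + Fintype.card ι * varianceTuple φ o / σ ^ 2 := fun o => by
    have := varianceTuple_nonneg (φ := φ) o
    positivity
  have h1 : ∀ o ∈ Finset.univ, 0 ≤ (1 + Fintype.card ι * varianceTuple φ o / σ ^ 2) *
      ‖featureWeight v Θ o - gain φ σ (Fintype.card ι) o •
          featureMean (signs τ o) (representation v φ σ τ ω Θ)‖ ^ 2 := fun o _ =>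
    mul_nonneg (hpos o).le (sq_nonneg _)
  have h2 : ∀ j ∈ (Finset.univ.image fun a => (ω a).1)ᶜ, 0 ≤ ‖noiseWeight v Θ j‖ ^ 2 :=
    fun j _ => sq_nonneg _
  have h1' := Finset.sum_nonneg h1
  have h2' := Finset.sum_nonneg h2
  have h4 : ∀ {x s t : ℝ}, 0 ≤ s → 0 ≤ t → x + s + t ≤ x → s = 0 ∧ t = 0 := by
    intro x s t hs ht h
    constructor <;> linarith
  refine ⟨by rw [add_assoc]; exact le_add_of_nonneg_right (add_nonneg h1' h2'),
    fun h => ⟨fun o => ?_, fun j hj => ?_⟩⟩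
  · have h3 := (Finset.sum_eq_zero_iff_of_nonneg h1).1 (h4 h1' h2' h).1 o (Finset.mem_univ o)
    rw [mul_eq_zero, or_iff_right (hpos o).ne', sq_eq_zero_iff, norm_eq_zero] at h3
    exact sub_eq_zero.1 h3
  · have h3 := (Finset.sum_eq_zero_iff_of_nonneg h2).1 (h4 h1' h2' h).2 j (by simpa using hj)
    simpa using h3

/-- A representation that minimizes `F`, and among the minimizers of `F` the squared norm of the
shortest interpolating model. -/
def IsOptimalRepresentation (φ : Fin K → ℝ) (σ : ℝ) (τ : ι → Fin K → ℤˣ)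
    (F : (ι → EuclideanSpace ℝ (Fin p)) → ℝ) (Z : ι → EuclideanSpace ℝ (Fin p)) : Prop :=
  (∀ Z', F Z ≤ F Z') ∧
    ∀ Z', (∀ Z'', F Z' ≤ F Z'') → interpolationCost φ σ τ Z ≤ interpolationCost φ σ τ Z'

variable {F : (ι → EuclideanSpace ℝ (Fin p)) → ℝ} {L : Params p d → ℝ}

/-- Every representation is attained, so nothing is lost by forgetting the model. -/
theorem isMinimizer_iff [Nonempty ι] (hσ : 0 < σ) (hω : Function.Injective fun a => (ω a).1)
    (hh : IsOrthonormalFamily (signs τ)) (hL : ∀ Θ, L Θ = F (representation v φ σ τ ω Θ))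
    (Θ : Params p d) :
    IsMinimizer L Θ ↔ ∀ Z', F (representation v φ σ τ ω Θ) ≤ F Z' := by
  constructor
  · intro h Z'
    obtain ⟨Θ', hΘ', -⟩ := exists_interpolation (v := v) (φ := φ) hσ hω hh Z'
    rw [← hΘ', ← hL, ← hL]
    exact h Θ'
  · intro h Θ'
    rw [hL, hL]
    exact h _

theorem IsMinNormMinimizer.isOptimalRepresentation [Nonempty ι] (hσ : 0 < σ)
    (hω : Function.Injective fun a => (ω a).1) (hh : IsOrthonormalFamily (signs τ))
    (hL : ∀ Θ, L Θ = F (representation v φ σ τ ω Θ)) {Θ : Params p d}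
    (hΘ : IsMinNormMinimizer L Θ) :
    IsOptimalRepresentation φ σ τ F (representation v φ σ τ ω Θ) ∧
      (∀ o, featureWeight v Θ o = gain φ σ (Fintype.card ι) o •
        featureMean (signs τ o) (representation v φ σ τ ω Θ)) ∧
      ∀ j, (∀ a, (ω a).1 ≠ j) → noiseWeight v Θ j = 0 := by
  have h1 := (isMinimizer_iff hσ hω hh hL Θ).1 hΘ.1
  have h2 : ∀ Z', (∀ Z'', F Z' ≤ F Z'') → frobeniusNorm Θ ^ 2 ≤ interpolationCost φ σ τ Z' := by
    intro Z' hZ'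
    obtain ⟨Θ', hΘ', hc, -⟩ := exists_interpolation (v := v) (φ := φ) hσ hω hh Z'
    rw [← hc]
    refine pow_le_pow_left₀ (Real.sqrt_nonneg _) (hΘ.2 Θ' ?_) 2
    rw [isMinimizer_iff hσ hω hh hL, hΘ']
    exact hZ'
  have h3 := interpolationCost_le (v := v) (φ := φ) hσ hω hh Θ
  exact ⟨⟨h1, fun Z' hZ' => h3.1.trans (h2 Z' hZ')⟩, h3.2 (h2 _ h1)⟩

theorem IsOptimalRepresentation.exists_isMinNormMinimizer [Nonempty ι] (hσ : 0 < σ)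
    (hω : Function.Injective fun a => (ω a).1) (hh : IsOrthonormalFamily (signs τ))
    (hL : ∀ Θ, L Θ = F (representation v φ σ τ ω Θ)) {Z : ι → EuclideanSpace ℝ (Fin p)}
    (hZ : IsOptimalRepresentation φ σ τ F Z) :
    ∃ Θ : Params p d, IsMinNormMinimizer L Θ := by
  obtain ⟨Θ, hΘ, hc, -⟩ := exists_interpolation (v := v) (φ := φ) hσ hω hh Z
  refine ⟨Θ, (isMinimizer_iff hσ hω hh hL Θ).2 (by rw [hΘ]; exact hZ.1), fun Θ' hΘ' => ?_⟩
  have h1 := hZ.2 _ ((isMinimizer_iff hσ hω hh hL Θ').1 hΘ')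
  have h2 := (interpolationCost_le (v := v) (φ := φ) hσ hω hh Θ').1
  exact (pow_le_pow_iff_left₀ (Real.sqrt_nonneg _) (Real.sqrt_nonneg _) two_ne_zero).1
    (hc.trans_le (h1.trans h2))

end Interpolation

/-! ### A linear program and the choice of the largest entries -/

section Threshold

variable {κ : Type*} [DecidableEq κ]

/-- The linear program `max ∑ ρ t` under `0 ≤ t ≤ u` and `∑ t ≤ u |T|` is solved by the indicator
of a set `T` of largest entries of `ρ`, separated from the other ones by the threshold `r`. -/
theorem sum_mul_le_of_threshold {S T : Finset κ} (hTS : T ⊆ S) {ρ t : κ → ℝ} {u r : ℝ}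
    (hr : 0 ≤ r) (ht0 : ∀ o ∈ S, 0 ≤ t o) (htu : ∀ o ∈ S, t o ≤ u)
    (hsum : ∑ o ∈ S, t o ≤ u * T.card) (hT : ∀ o ∈ T, r ≤ ρ o)
    (hnT : ∀ o ∈ S, o ∉ T → ρ o ≤ r) :
    ∑ o ∈ S, ρ o * t o ≤ ∑ o ∈ T, ρ o * u ∧
      (∑ o ∈ T, ρ o * u ≤ ∑ o ∈ S, ρ o * t o →
        (∀ o ∈ S, ρ o < r → t o = 0) ∧ ∀ o ∈ S, r < ρ o → t o = u) := by
  have hgap : ∀ o ∈ S, 0 ≤ (ρ o - r) * ((if o ∈ T then u else 0) - t o) := by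
    intro o ho
    split_ifs with h
    · exact mul_nonneg (sub_nonneg.2 (hT o h)) (sub_nonneg.2 (htu o ho))
    · exact mul_nonneg_of_nonpos_of_nonpos (sub_nonpos.2 (hnT o ho h)) (by linarith [ht0 o ho])
  have hite : ∀ f : κ → ℝ, ∑ o ∈ S, f o * (if o ∈ T then u else 0) = ∑ o ∈ T, f o * u := by
    intro f
    simp only [mul_ite, mul_zero]
    rw [Finset.sum_ite_mem, Finset.inter_eq_right.2 hTS]
  -- Linear programming duality with `r` as the price of the budget: the gap is a sum of nonnegative
  -- terms, so at the optimum each term vanishes, which fixes `t` wherever `ρ ≠ r`.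
  have hid : ∑ o ∈ T, ρ o * u - ∑ o ∈ S, ρ o * t o =
      ∑ o ∈ S, (ρ o - r) * ((if o ∈ T then u else 0) - t o) + r * (u * T.card - ∑ o ∈ S, t o) := by
    simp only [mul_sub, Finset.sum_sub_distrib, hite]
    simp only [sub_mul, Finset.sum_sub_distrib, ← Finset.mul_sum, Finset.sum_const, nsmul_eq_mul]
    ring
  have h1 := Finset.sum_nonneg hgap
  have h2 := mul_nonneg hr (sub_nonneg.2 hsum)
  refine ⟨by linarith, fun h => ?_⟩
  have h3 := (Finset.sum_eq_zero_iff_of_nonneg hgap).1 (by linarith)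
  constructor
  · intro o ho hlt
    have hoT : o ∉ T := fun h => absurd (hT o h) (not_le.2 hlt)
    have := h3 o ho
    rw [if_neg hoT, mul_eq_zero, or_iff_right (sub_ne_zero.2 hlt.ne)] at this
    linarith
  · intro o ho hlt
    have hoT : o ∈ T := by by_contra h; exact absurd (hnT o ho h) (not_le.2 hlt)
    have := h3 o ho
    rw [if_pos hoT, mul_eq_zero, or_iff_right (sub_ne_zero.2 hlt.ne')] at this
    linarith

theorem exists_largest [Fintype κ] (f : κ → ℝ) {p : ℕ} (hp : p ≤ Fintype.card κ) :
    ∃ T : Finset κ, T.card = p ∧ ∀ o ∈ T, ∀ o' ∉ T, f o' ≤ f o := by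
  induction p with
  | zero => exact ⟨∅, rfl, by simp⟩
  | succ p ih =>
    obtain ⟨T, hT, hTf⟩ := ih (by omega)
    have hne : (Tᶜ).Nonempty := by
      rw [← Finset.card_pos, Finset.card_compl]; omega
    obtain ⟨x, hx, hxf⟩ := Finset.exists_max_image Tᶜ f hne
    rw [Finset.mem_compl] at hx
    refine ⟨insert x T, by rw [Finset.card_insert_of_notMem hx, hT], fun o ho o' ho' => ?_⟩
    rw [Finset.mem_insert, not_or] at ho'
    rcases Finset.mem_insert.1 ho with rfl | ho
    · exact hxf o' (Finset.mem_compl.2 ho'.2)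
    · exact hTf o ho o' ho'.2

/-- If an entry is not among the `p` largest ones, it is smaller than all entries of some set of
`p` largest ones. -/
theorem exists_largest_of_not_isAmongLargest [Fintype κ] {f : κ → ℝ} {p : ℕ} (hp : 0 < p) {c : κ}
    (hc : ¬ IsAmongLargest p f c) :
    ∃ T : Finset κ, T.card = p ∧ ∃ m, f c < f m ∧ (∀ o ∈ T, f m ≤ f o) ∧ ∀ o ∉ T, f o ≤ f m := by
  rw [IsAmongLargest, not_lt, Set.ncard_eq_toFinset_card'] at hc
  obtain ⟨T, hT, hTf⟩ := exists_largest f (hc.trans (Finset.card_le_univ _))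
  obtain ⟨m, hm, hmf⟩ := Finset.exists_min_image T f (by rw [← Finset.card_pos]; omega)
  refine ⟨T, hT, m, ?_, hmf, hTf m hm⟩
  -- Otherwise every entry above `f c` would lie in `T` without `m`, which has only `p - 1`
  -- elements.
  by_contra! hle
  have hsub : {j | f c < f j}.toFinset ⊆ T.erase m := by
    intro j hj
    rw [Set.mem_toFinset, Set.mem_ofPred_eq] at hj
    rw [Finset.mem_erase]
    refine ⟨fun h => ?_, ?_⟩
    · rw [h] at hj; exact absurd hle (not_le.2 hj)
    · by_contra hjT
      exact absurd ((hTf m hm j hjT).trans hle) (not_le.2 hj)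
  have := Finset.card_le_card hsub
  rw [Finset.card_erase_of_mem hm, hT] at this
  omega

end Threshold

/-! ### Explicit representations made of scaled features -/

section Candidates

variable {ι κ γ : Type*} [Fintype ι] [DecidableEq κ] [DecidableEq γ] {p : ℕ}

/-- The representation whose `i`-th coordinate is a multiple of the function `h (e i)`. -/
def coordinateRepresentation (h : κ → ι → ℝ) (e : Fin p → κ) (s : Fin p → ℝ) (a : ι) :
    EuclideanSpace ℝ (Fin p) :=
  WithLp.toLp 2 fun i => s i * h (e i) a

variable {h : κ → ι → ℝ} {e : Fin p → κ} (s : Fin p → ℝ)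

theorem secondMoment_coordinateRepresentation (hh : IsOrthonormalFamily h)
    (he : Function.Injective e) (i j : Fin p) :
    secondMoment (coordinateRepresentation h e s) i j = if i = j then s i ^ 2 else 0 := by
  have : ∀ a, (coordinateRepresentation h e s a) i * (coordinateRepresentation h e s a) j =
      s i * s j * (h (e i) a * h (e j) a) := fun a => by
    simp only [coordinateRepresentation]; ring
  simp only [secondMoment, this, ← Finset.mul_expect, hh (e i), he.eq_iff]
  split_ifs with hij
  · rw [hij]; ring
  · ring

theorem featureMean_coordinateRepresentation (hh : IsOrthonormalFamily h) (o : κ) (i : Fin p) :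
    featureMean (h o) (coordinateRepresentation h e s) i = if o = e i then s i else 0 := by
  have : ∀ a, h o a * (coordinateRepresentation h e s a) i = s i * (h o a * h (e i) a) :=
    fun a => by simp only [coordinateRepresentation]; ring
  simp only [featureMean_apply, this, ← Finset.mul_expect, hh o]
  split_ifs <;> ring

theorem norm_featureMean_coordinateRepresentation (hh : IsOrthonormalFamily h)
    (he : Function.Injective e) (i : Fin p) :
    ‖featureMean (h (e i)) (coordinateRepresentation h e s)‖ ^ 2 = s i ^ 2 := by
  rw [norm_sq_eq_sum]
  simp [featureMean_coordinateRepresentation s hh, he.eq_iff]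

theorem sum_mul_norm_featureMean_coordinateRepresentation (hh : IsOrthonormalFamily h)
    (S : Finset κ) (ρ : κ → ℝ) :
    ∑ o ∈ S, ρ o * ‖featureMean (h o) (coordinateRepresentation h e s)‖ ^ 2 =
      ∑ i, if e i ∈ S then ρ (e i) * s i ^ 2 else 0 := by
  simp only [norm_sq_eq_sum, featureMean_coordinateRepresentation s hh, ite_pow,
    zero_pow two_ne_zero, Finset.mul_sum, mul_ite, mul_zero]
  rw [Finset.sum_comm]
  refine Finset.sum_congr rfl fun i _ => ?_
  rw [Finset.sum_ite_eq' S (e i) fun o => ρ o * s i ^ 2]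

theorem pairLoss_coordinateRepresentation (hh : IsOrthonormalFamily h)
    (he : Function.Injective e) {g : ι → γ} (hg : ∀ o a b, g b = g a → h o b = h o a) :
    pairLoss g (coordinateRepresentation h e s) = ∑ i, s i ^ 4 - 2 * ∑ i, s i ^ 2 := by
  rw [pairLoss, expect_expect_inner_sq, positiveTerm_eq]
  · simp only [secondMoment_coordinateRepresentation s hh he, if_true, ite_pow,
      zero_pow two_ne_zero, Finset.sum_ite_eq, Finset.mem_univ, ← pow_mul]
    ring
  · intro a b hab
    simp only [coordinateRepresentation, hg _ a b hab]

theorem pairLoss_label_coordinateRepresentation [Nonempty ι] (hh : IsOrthonormalFamily h)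
    (he : Function.Injective e) {i₀ i₁ : Fin p} (h01 : i₀ ≠ i₁) (hn : ∀ a, h (e i₀) a = 1)
    {y : ι → ℤˣ} (hc : ∀ a, h (e i₁) a = ((y a : ℤ) : ℝ)) :
    pairLoss y (coordinateRepresentation h e s) =
      ∑ i, s i ^ 4 - 2 * (s i₀ ^ 2 + s i₁ ^ 2) := by
  have hy : 𝔼 a, ((y a : ℤ) : ℝ) = 0 := by
    have := hh (e i₀) (e i₁)
    simpa [hn, hc, he.eq_iff, h01] using this
  rw [pairLoss, expect_expect_inner_sq, positiveTerm_label y hy]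
  rw [show (fun _ : ι => (1 : ℝ)) = h (e i₀) from (funext hn).symm,
    show (fun a => ((y a : ℤ) : ℝ)) = h (e i₁) from (funext hc).symm,
    norm_featureMean_coordinateRepresentation s hh he,
    norm_featureMean_coordinateRepresentation s hh he]
  simp only [secondMoment_coordinateRepresentation s hh he, ite_pow,
    zero_pow two_ne_zero, Finset.sum_ite_eq, Finset.mem_univ, if_true, ← pow_mul]
  ring

end Candidates

/-! ### Shortest optimal representations for the three losses -/

section OptimalRepresentations

variable {ι γ : Type*} [Fintype ι] [DecidableEq γ] {K p : ℕ} {φ : Fin K → ℝ} {σ : ℝ}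
  {τ : ι → Fin K → ℤˣ} {g : ι → γ}

/-! ### The supervised loss -/

/-- An enumeration of the constant and the first `p - 1` features. -/
def leadingFeatures (hpK : p ≤ K) (i : Fin p) : Option (Fin K) :=
  if (i : ℕ) = 0 then none else some ⟨i - 1, by omega⟩

theorem leadingFeatures_injective (hpK : p ≤ K) : Function.Injective (leadingFeatures hpK) := by
  intro i j hij
  simp only [leadingFeatures] at hij
  ext
  split_ifs at hij with h1 h2
  · omega
  · simp only [Option.some.injEq, Fin.mk.injEq] at hij; omega

/-- The coordinates of the constant and of the first feature. -/
def leadingPair (hp : 2 ≤ p) : Finset (Fin p) := {⟨0, by omega⟩, ⟨1, by omega⟩}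

theorem card_leadingPair (hp : 2 ≤ p) : (leadingPair hp).card = 2 :=
  Finset.card_pair (by simp)

/-- The optimal representation for the joint loss with parameter `β`. -/
def jointRepresentation (τ : ι → Fin K → ℤˣ) (hp : 2 ≤ p) (hpK : p ≤ K) (β : ℝ) :
    ι → EuclideanSpace ℝ (Fin p) :=
  coordinateRepresentation (signs τ) (leadingFeatures hpK)
    fun i => Real.sqrt (jointWeight β (leadingPair hp) i)

theorem sq_sqrt_jointWeight {β : ℝ} (hβ : β ≤ 1) (A : Finset (Fin p)) (i : Fin p) :
    Real.sqrt (jointWeight β A i) ^ 2 = jointWeight β A i := by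
  refine Real.sq_sqrt ?_
  unfold jointWeight
  split_ifs <;> linarith

theorem sum_sqrt_jointWeight_sq {β : ℝ} (hβ : β ≤ 1) (hp : 2 ≤ p) :
    ∑ i, Real.sqrt (jointWeight β (leadingPair hp) i) ^ 2 = 2 + (p - 2) * (1 - β) := by
  simp only [sq_sqrt_jointWeight hβ]
  simpa using sum_jointWeight β _ (card_leadingPair hp) fun x => x

theorem sum_sqrt_jointWeight_pow_four {β : ℝ} (hβ : β ≤ 1) (hp : 2 ≤ p) :
    ∑ i, Real.sqrt (jointWeight β (leadingPair hp) i) ^ 4 = 2 + (p - 2) * (1 - β) ^ 2 := by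
  have h4 : ∀ x : ℝ, x ^ 4 = (x ^ 2) ^ 2 := fun x => by ring
  simp only [h4, sq_sqrt_jointWeight hβ]
  exact (sum_jointWeight β _ (card_leadingPair hp) fun x => x ^ 2).trans (by ring)

theorem pairLoss_label_jointRepresentation [Nonempty ι] (hh : IsOrthonormalFamily (signs τ))
    (hp : 2 ≤ p)
    (hpK : p ≤ K) {β : ℝ} (hβ : β ≤ 1) {cls : Fin K} (hcls : (cls : ℕ) = 0) :
    pairLoss (fun a => τ a cls) (jointRepresentation τ hp hpK β) =
      (p - 2) * (1 - β) ^ 2 - 2 := by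
  have h1 := pairLoss_label_coordinateRepresentation (e := leadingFeatures hpK)
    (fun i => Real.sqrt (jointWeight β (leadingPair hp) i)) hh (leadingFeatures_injective hpK)
    (i₀ := ⟨0, by omega⟩) (i₁ := ⟨1, by omega⟩) (by simp) (y := fun a => τ a cls)
    (fun a => by simp [leadingFeatures, signs, featureSign])
    (fun a => by
      have : (⟨0, by omega⟩ : Fin K) = cls := Fin.ext hcls.symm
      simp [leadingFeatures, signs, featureSign, this])
  rw [jointRepresentation, h1, sum_sqrt_jointWeight_pow_four hβ, sq_sqrt_jointWeight hβ,
    sq_sqrt_jointWeight hβ]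
  simp only [jointWeight, leadingPair, Finset.mem_insert, Finset.mem_singleton, true_or, or_true,
    if_true]
  ring

theorem pairLoss_jointRepresentation (hh : IsOrthonormalFamily (signs τ)) (hp : 2 ≤ p)
    (hpK : p ≤ K) {β : ℝ} (hβ : β ≤ 1) (hg : ∀ a b, g b = g a → τ b = τ a) :
    pairLoss g (jointRepresentation τ hp hpK β) =
      2 + (p - 2) * (1 - β) ^ 2 - 2 * (2 + (p - 2) * (1 - β)) := by
  rw [jointRepresentation, pairLoss_coordinateRepresentation _ hh (leadingFeatures_injective hpK)
    fun o a b hab => by simp only [signs, hg a b hab], sum_sqrt_jointWeight_pow_four hβ,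
    sum_sqrt_jointWeight_sq hβ]

theorem expect_label_eq_zero (hh : IsOrthonormalFamily (signs τ)) (k : Fin K) :
    𝔼 a, ((τ a k : ℤ) : ℝ) = 0 := by
  simpa [signs, featureSign] using hh none (some k)

/-- A minimizer of the supervised loss only depends on the label. -/
theorem inner_eq_of_isMinimizer_label [Nonempty ι] (hh : IsOrthonormalFamily (signs τ)) (hp : 2 ≤ p)
    (hpK : p ≤ K) {cls : Fin K} (hcls : (cls : ℕ) = 0) {Z : ι → EuclideanSpace ℝ (Fin p)}
    (hZ : ∀ Z' : ι → EuclideanSpace ℝ (Fin p),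
        pairLoss (fun a => τ a cls) Z ≤ pairLoss (fun a => τ a cls) Z') (a b : ι) :
    inner ℝ (Z a) (Z b) = 1 * 1 + signs τ (some cls) a * signs τ (some cls) b := by
  -- At `β = 1` the weights `1 - β` vanish and only the constant and the label remain, which attains
  -- the bound `-2`.
  have h1 := hZ (jointRepresentation τ hp hpK 1)
  rw [pairLoss_label_jointRepresentation hh hp hpK le_rfl hcls] at h1
  rw [one_mul]
  exact inner_eq_of_pairLoss_label_le _ (expect_label_eq_zero hh cls) (by linarith) a b

theorem norm_featureMean_of_isMinimizer_label [Nonempty ι] (hh : IsOrthonormalFamily (signs τ))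
    (hp : 2 ≤ p)
    (hpK : p ≤ K) {cls : Fin K} (hcls : (cls : ℕ) = 0) {Z : ι → EuclideanSpace ℝ (Fin p)}
    (hZ : ∀ Z' : ι → EuclideanSpace ℝ (Fin p),
        pairLoss (fun a => τ a cls) Z ≤ pairLoss (fun a => τ a cls) Z')
    (o : Option (Fin K)) :
    ‖featureMean (signs τ o) Z‖ ^ 2 =
      (if o = none then 1 else 0) + if o = some cls then 1 else 0 := by
  rw [norm_featureMean_sq]
  have h1 : ∀ a b, signs τ o a * signs τ o b * inner ℝ (Z a) (Z b) =
      (signs τ o a * signs τ none a) * (signs τ o b * signs τ none b) +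
      (signs τ o a * signs τ (some cls) a) * (signs τ o b * signs τ (some cls) b) := by
    intro a b
    rw [inner_eq_of_isMinimizer_label hh hp hpK hcls hZ]
    simp only [signs, featureSign]; ring
  simp only [h1, Finset.expect_add_distrib, ← Finset.mul_expect, ← Finset.expect_mul, hh o]
  split_ifs <;> simp

theorem featureMean_of_isMinimizer_label [Nonempty ι] (hh : IsOrthonormalFamily (signs τ))
    (hp : 2 ≤ p)
    (hpK : p ≤ K) {cls : Fin K} (hcls : (cls : ℕ) = 0) {Z : ι → EuclideanSpace ℝ (Fin p)}
    (hZ : ∀ Z' : ι → EuclideanSpace ℝ (Fin p),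
        pairLoss (fun a => τ a cls) Z ≤ pairLoss (fun a => τ a cls) Z')
    {k : Fin K} (hk : k ≠ cls) : featureMean (signs τ (some k)) Z = 0 := by
  have := norm_featureMean_of_isMinimizer_label hh hp hpK hcls hZ (some k)
  simpa [hk] using this

theorem exists_isOptimalRepresentation_label [Nonempty ι] (hh : IsOrthonormalFamily (signs τ))
    (hp : 2 ≤ p)
    (hpK : p ≤ K) {cls : Fin K} (hcls : (cls : ℕ) = 0) :
    ∃ Z : ι → EuclideanSpace ℝ (Fin p),
      IsOptimalRepresentation φ σ τ (pairLoss fun a => τ a cls) Z := by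
  have hmin : ∀ Z' : ι → EuclideanSpace ℝ (Fin p),
      pairLoss (fun a => τ a cls) (jointRepresentation τ hp hpK 1) ≤
        pairLoss (fun a => τ a cls) Z' := by
    intro Z'
    rw [pairLoss_label_jointRepresentation hh hp hpK le_rfl hcls]
    have := le_pairLoss_label _ (expect_label_eq_zero hh cls) Z'
    linarith
  refine ⟨jointRepresentation τ hp hpK 1, hmin, fun Z' hZ' => le_of_eq ?_⟩
  -- The cost depends on `Z` only through its Gram matrix, which all minimizers share; hence every
  -- minimizer is optimal.
  have hn : ∀ Z : ι → EuclideanSpace ℝ (Fin p),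
      (∀ Z' : ι → EuclideanSpace ℝ (Fin p),
          pairLoss (fun a => τ a cls) Z ≤ pairLoss (fun a => τ a cls) Z') →
      ∀ a, ‖Z a‖ ^ 2 = 1 * 1 + signs τ (some cls) a * signs τ (some cls) a := fun Z hZ a => by
    rw [← real_inner_self_eq_norm_sq, inner_eq_of_isMinimizer_label hh hp hpK hcls hZ]
  simp only [interpolationCost, norm_featureMean_of_isMinimizer_label hh hp hpK hcls hmin,
    norm_featureMean_of_isMinimizer_label hh hp hpK hcls hZ', hn _ hmin, hn _ hZ']

/-! ### The unsupervised loss -/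

theorem pairLoss_coordinateRepresentation_one (hh : IsOrthonormalFamily (signs τ))
    (hg : ∀ a b, g b = g a → τ b = τ a) {e : Fin p → Option (Fin K)}
    (he : Function.Injective e) :
    pairLoss g (coordinateRepresentation (signs τ) e fun _ => 1) = -p := by
  rw [pairLoss_coordinateRepresentation _ hh he fun o a b hab => by simp only [signs, hg a b hab]]
  simp
  ring

theorem isMinimizer_coordinateRepresentation_one (hh : IsOrthonormalFamily (signs τ))
    (hg : ∀ a b, g b = g a → τ b = τ a) {e : Fin p → Option (Fin K)}
    (he : Function.Injective e) (Z : ι → EuclideanSpace ℝ (Fin p)) :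
    pairLoss g (coordinateRepresentation (signs τ) e fun _ => 1) ≤ pairLoss g Z :=
  (pairLoss_coordinateRepresentation_one hh hg he).trans_le (neg_le_pairLoss g Z)

theorem secondMoment_of_isMinimizer (hh : IsOrthonormalFamily (signs τ)) (hpK : p ≤ K)
    (hg : ∀ a b, g b = g a → τ b = τ a) {Z : ι → EuclideanSpace ℝ (Fin p)}
    (hZ : ∀ Z' : ι → EuclideanSpace ℝ (Fin p), pairLoss g Z ≤ pairLoss g Z') (i j : Fin p) :
    secondMoment Z i j = if i = j then 1 else 0 :=
  secondMoment_of_pairLoss_le g ((hZ _).trans_eq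
    (pairLoss_coordinateRepresentation_one hh hg (leadingFeatures_injective hpK))) i j

/-- Any `p` distinct functions among the constant and the features attain the minimum, so the class
may be one of them: suppression comes from the norm, not from the loss. -/
theorem exists_isMinimizer_norm_featureMean_eq_one (hh : IsOrthonormalFamily (signs τ))
    (hp : 2 ≤ p) (hpK : p ≤ K) (hg : ∀ a b, g b = g a → τ b = τ a) {cls : Fin K}
    (hcls : (cls : ℕ) = 0) :
    ∃ Z : ι → EuclideanSpace ℝ (Fin p),
        (∀ Z' : ι → EuclideanSpace ℝ (Fin p), pairLoss g Z ≤ pairLoss g Z') ∧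
      ‖featureMean (signs τ (some cls)) Z‖ = 1 := by
  refine ⟨_, isMinimizer_coordinateRepresentation_one hh hg (leadingFeatures_injective hpK), ?_⟩
  have h1 := norm_featureMean_coordinateRepresentation (fun _ => 1) hh
    (leadingFeatures_injective hpK) ⟨1, by omega⟩
  have h2 : leadingFeatures hpK ⟨1, by omega⟩ = some cls := by
    simp [leadingFeatures, Fin.ext_iff, hcls]
  rw [h2] at h1
  have h3 := norm_nonneg (featureMean (signs τ (some cls))
    (coordinateRepresentation (signs τ) (leadingFeatures hpK) fun _ => 1))
  nlinarith

/-- At a minimizer `𝔼‖Z‖² = p`, so the cost depends only on `‖ζ_o‖²`, subject to an upper bound `1`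
and a budget `p`. Filling a set of `p` largest variances is optimal, and the class lies strictly
below the threshold, so it receives nothing even when there are ties at the threshold. -/
theorem optimalRepresentation_example [Nonempty ι] (hh : IsOrthonormalFamily (signs τ)) (hσ : 0 < σ)
    (hp : 0 < p) (hpK : p ≤ K) (hg : ∀ a b, g b = g a → τ b = τ a) {cls : Fin K}
    (hc : ¬ IsAmongLargest p (varianceTuple φ) (some cls)) :
    (∃ Z : ι → EuclideanSpace ℝ (Fin p), IsOptimalRepresentation φ σ τ (pairLoss g) Z) ∧
    ∀ Z : ι → EuclideanSpace ℝ (Fin p), IsOptimalRepresentation φ σ τ (pairLoss g) Z →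
      featureMean (signs τ (some cls)) Z = 0 := by
  have hN : (0 : ℝ) < Fintype.card ι := by exact_mod_cast Fintype.card_pos
  obtain ⟨T, hT, m, hcm, hmT, hTm⟩ := exists_largest_of_not_isAmongLargest hp hc
  let e : Fin p → Option (Fin K) := fun i => (T.equivFinOfCardEq hT).symm i
  have he : Function.Injective e :=
    Subtype.val_injective.comp (T.equivFinOfCardEq hT).symm.injective
  set ρ : Option (Fin K) → ℝ := fun o => saving σ (Fintype.card ι : ℝ) (varianceTuple φ o) with hρ
  have hmono : ∀ o o', varianceTuple φ o ≤ varianceTuple φ o' → ρ o ≤ ρ o' := fun o o' h =>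
    saving_le_saving hσ hN (varianceTuple_nonneg o) h
  have hlp : ∀ Z : ι → EuclideanSpace ℝ (Fin p),
      (∀ Z' : ι → EuclideanSpace ℝ (Fin p), pairLoss g Z ≤ pairLoss g Z') →
      ∑ o ∈ Finset.univ, ρ o * ‖featureMean (signs τ o) Z‖ ^ 2 ≤ ∑ o ∈ T, ρ o * 1 ∧
        (∑ o ∈ T, ρ o * 1 ≤ ∑ o ∈ Finset.univ, ρ o * ‖featureMean (signs τ o) Z‖ ^ 2 →
          (∀ o ∈ Finset.univ, ρ o < ρ m → ‖featureMean (signs τ o) Z‖ ^ 2 = 0) ∧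
            ∀ o ∈ Finset.univ, ρ m < ρ o → ‖featureMean (signs τ o) Z‖ ^ 2 = 1) :=
    fun Z hZ => by
      have hM := secondMoment_of_isMinimizer hh hpK hg hZ
      refine sum_mul_le_of_threshold (S := Finset.univ) (T := T) (ρ := ρ)
        (t := fun o => ‖featureMean (signs τ o) Z‖ ^ 2) (u := 1) (r := ρ m) T.subset_univ
        (saving_nonneg hN.le (varianceTuple_nonneg m)) (fun o _ => sq_nonneg _)
        (fun o _ => ?_) ?_ (fun o ho => hmono _ _ (hmT o ho)) (fun o _ ho => hmono _ _ (hTm o ho))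
      · exact (norm_featureMean_sq_le_of_secondMoment (by simpa using hh o o) (w := fun _ => 1) hM
          one_pos fun _ _ => rfl).1
      · refine (sum_norm_featureMean_sq_le hh _ Z Finset.univ (by simp)).trans_eq ?_
        simp [hM, hT]
  have hcost : ∀ Z : ι → EuclideanSpace ℝ (Fin p),
      (∀ Z' : ι → EuclideanSpace ℝ (Fin p), pairLoss g Z ≤ pairLoss g Z') →
      interpolationCost φ σ τ Z =
        Fintype.card ι / σ ^ 2 * p - ∑ o, ρ o * ‖featureMean (signs τ o) Z‖ ^ 2 := by
    intro Z hZ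
    rw [interpolationCost, expect_norm_sq]
    simp [secondMoment_of_isMinimizer hh hpK hg hZ, hρ]
  have hcand := isMinimizer_coordinateRepresentation_one (g := g) hh hg he
  have hcand2 : ∑ o, ρ o *
      ‖featureMean (signs τ o) (coordinateRepresentation (signs τ) e fun _ => 1)‖ ^ 2 =
      ∑ o ∈ T, ρ o * 1 := by
    rw [sum_mul_norm_featureMean_coordinateRepresentation _ hh]
    simp only [Finset.mem_univ, if_true, one_pow]
    rw [Equiv.sum_comp (T.equivFinOfCardEq hT).symm fun o => ρ o * 1,
      Finset.sum_coe_sort T fun o => ρ o * 1]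
  refine ⟨⟨_, hcand, fun Z' hZ' => ?_⟩, fun Z hZ => ?_⟩
  · rw [hcost _ hcand, hcost _ hZ', hcand2]
    linarith [(hlp Z' hZ').1]
  · have h1 := hZ.2 _ hcand
    rw [hcost _ hcand, hcost _ hZ.1, hcand2] at h1
    have h2 := ((hlp Z hZ.1).2 (by linarith)).1 (some cls) (Finset.mem_univ _)
      (saving_lt_saving hσ hN (varianceTuple_nonneg _) hcm)
    simpa using h2

/-! ### The joint loss -/

theorem jointPairLoss_jointRepresentation [Nonempty ι] (hh : IsOrthonormalFamily (signs τ))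
    (hp : 2 ≤ p)
    (hpK : p ≤ K) {β : ℝ} (hβ : β ≤ 1) (hg : ∀ a b, g b = g a → τ b = τ a)
    {cls : Fin K} (hcls : (cls : ℕ) = 0) :
    jointPairLoss β (fun a => τ a cls) g (jointRepresentation τ hp hpK β) =
      -(2 + (p - 2) * (1 - β) ^ 2) := by
  rw [jointPairLoss, pairLoss_label_jointRepresentation hh hp hpK hβ hcls,
    pairLoss_jointRepresentation hh hp hpK hβ hg]
  ring

/-- The constant and the class are fixed by optimality for the loss. The other features share the
budget `(1 - β)(p - 2)` with cap `1 - β`; the subclass lies strictly above the threshold and is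
filled to the cap. -/
theorem optimalRepresentation_joint [Nonempty ι] (hh : IsOrthonormalFamily (signs τ)) (hσ : 0 < σ)
    (hp : 3 ≤ p) (hpK : p ≤ K) (hg : ∀ a b, g b = g a → τ b = τ a) {cls sub pth : Fin K}
    (hcls : (cls : ℕ) = 0) (hsub : (sub : ℕ) = 1) (hpth : (pth : ℕ) = p - 1)
    (hsorted : ∀ k l : Fin K, 2 ≤ (k : ℕ) → k ≤ l → φ l ^ 2 ≤ φ k ^ 2)
    (hsubp : φ pth ^ 2 < φ sub ^ 2) {β : ℝ} (hβ0 : 0 < β) (hβ1 : β < 1) :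
    (∃ Z : ι → EuclideanSpace ℝ (Fin p),
      IsOptimalRepresentation φ σ τ (jointPairLoss β (fun a => τ a cls) g) Z) ∧
    ∀ Z : ι → EuclideanSpace ℝ (Fin p),
      IsOptimalRepresentation φ σ τ (jointPairLoss β (fun a => τ a cls) g) Z →
      ‖featureMean (signs τ (some cls)) Z‖ ^ 2 = 1 ∧
      ‖featureMean (signs τ (some sub)) Z‖ ^ 2 = 1 - β ∧
      (∀ a, inner ℝ (featureMean (signs τ (some cls)) Z) (Z a) = signs τ (some cls) a) ∧
      ∀ a, inner ℝ (featureMean (signs τ (some sub)) Z) (Z a) =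
        (1 - β) * signs τ (some sub) a := by
  have hp2 : 2 ≤ p := by omega
  have hN : (0 : ℝ) < Fintype.card ι := by exact_mod_cast Fintype.card_pos
  set F := jointPairLoss (p := p) β (fun a => τ a cls) g with hF
  set ρ : Option (Fin K) → ℝ := fun o => saving σ (Fintype.card ι : ℝ) (varianceTuple φ o) with hρ
  have hmono : ∀ o o', varianceTuple φ o ≤ varianceTuple φ o' → ρ o ≤ ρ o' := fun o o' h =>
    saving_le_saving hσ hN (varianceTuple_nonneg o) h
  have hopt : ∀ Z : ι → EuclideanSpace ℝ (Fin p), (∀ Z', F Z ≤ F Z') →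
      IsJointOptimal (signs τ) none (some cls) β Z := fun Z hZ =>
    isJointOptimal_of_le hh (by simp) (fun _ => rfl) (fun _ => rfl) g hβ0 hβ1 hp2
      ((hZ _).trans_eq (jointPairLoss_jointRepresentation hh hp2 hpK hβ1.le hg hcls))
  have hcand : ∀ Z', F (jointRepresentation τ hp2 hpK β) ≤ F Z' := fun Z' =>
    (jointPairLoss_jointRepresentation hh hp2 hpK hβ1.le hg hcls).trans_le
      (neg_le_jointPairLoss hh (n := none) (c := some cls) (by simp) (fun _ => rfl)
          (fun _ => rfl) g hβ0 hβ1 hp2 Z')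
  let S : Finset (Option (Fin K)) := {none, some cls}ᶜ
  have hnS : none ∉ S := by simp [S]
  have hcS : some cls ∉ S := by simp [S]
  -- The features of index `1` to `p - 2`, counted from zero, have the `p - 2` largest variances
  -- outside the constant and the class, up to ties. The next one, `pth`, serves as threshold. As `p
  -- ≥ 3`, the subclass is in `T`.
  let T : Finset (Option (Fin K)) := (leadingPair hp2)ᶜ.image (leadingFeatures hpK)
  have hTcard : (T.card : ℝ) = p - 2 := by
    rw [Finset.card_image_of_injective _ (leadingFeatures_injective hpK), Finset.card_compl,
      card_leadingPair, Fintype.card_fin, Nat.cast_sub hp2]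
    norm_num
  have hmemT : ∀ k : Fin K, some k ∈ T ↔ 1 ≤ (k : ℕ) ∧ (k : ℕ) < p - 1 := by
    intro k
    simp only [T, Finset.mem_image, Finset.mem_compl, leadingPair, Finset.mem_insert,
      Finset.mem_singleton, not_or, leadingFeatures, Fin.ext_iff]
    constructor
    · rintro ⟨i, ⟨h0, h1⟩, h⟩
      rw [if_neg h0, Option.some.injEq, Fin.ext_iff] at h
      simp only at h
      omega
    · rintro ⟨h1, h2⟩
      refine ⟨⟨k + 1, by omega⟩, ⟨by simp, by simp; omega⟩, ?_⟩
      simp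
  have hTS : T ⊆ S := by
    intro o ho
    simp only [S, Finset.mem_compl, Finset.mem_insert, Finset.mem_singleton, not_or]
    constructor
    · rintro rfl
      simp only [T, Finset.mem_image, Finset.mem_compl, leadingPair, Finset.mem_insert,
        Finset.mem_singleton, not_or, leadingFeatures, Fin.ext_iff] at ho
      obtain ⟨i, ⟨h0, h1⟩, h⟩ := ho
      rw [if_neg h0] at h
      exact absurd h (by simp)
    · rintro rfl
      rw [hmemT] at ho; omega
  have hsumS : ∀ f : Option (Fin K) → ℝ, ∑ o, f o = f none + f (some cls) + ∑ o ∈ S, f o := by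
    intro f
    rw [← Finset.sum_add_sum_compl {none, some cls}, Finset.sum_pair (by simp)]
  have hcost : ∀ Z : ι → EuclideanSpace ℝ (Fin p), (∀ Z', F Z ≤ F Z') →
      interpolationCost φ σ τ Z = Fintype.card ι / σ ^ 2 * (2 + (p - 2) * (1 - β)) -
        (ρ none + ρ (some cls) + ∑ o ∈ S, ρ o * ‖featureMean (signs τ o) Z‖ ^ 2) := by
    intro Z hZ
    have h := hopt Z hZ
    rw [interpolationCost, h.expect_norm_sq, hsumS, h.norm_const, h.norm_label]
    simp only [hρ, mul_one]
  have hlp : ∀ Z : ι → EuclideanSpace ℝ (Fin p), (∀ Z', F Z ≤ F Z') →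
      ∑ o ∈ S, ρ o * ‖featureMean (signs τ o) Z‖ ^ 2 ≤ ∑ o ∈ T, ρ o * (1 - β) ∧
        (∑ o ∈ T, ρ o * (1 - β) ≤ ∑ o ∈ S, ρ o * ‖featureMean (signs τ o) Z‖ ^ 2 →
          (∀ o ∈ S, ρ o < ρ (some pth) → ‖featureMean (signs τ o) Z‖ ^ 2 = 0) ∧
            ∀ o ∈ S, ρ (some pth) < ρ o →
                ‖featureMean (signs τ o) Z‖ ^ 2 = (1 - β)) := fun Z hZ => by
    have h := hopt Z hZ
    refine sum_mul_le_of_threshold (S := S) (T := T) (ρ := ρ)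
      (t := fun o => ‖featureMean (signs τ o) Z‖ ^ 2) (u := 1 - β) (r := ρ (some pth)) hTS
      (saving_nonneg hN.le (varianceTuple_nonneg _)) (fun o _ => sq_nonneg _)
      (fun o ho => h.norm_le o ?_ ?_) ?_ (fun o ho => ?_) (fun o hoS hoT => ?_)
    · rintro rfl; exact hnS ho
    · rintro rfl; exact hcS ho
    · rw [hTcard]; exact h.sum_le S hnS hcS
    · cases o with
      | none => exact absurd (hTS ho) hnS
      | some k =>
        rw [hmemT] at ho
        refine hmono _ _ ?_
        rcases eq_or_ne k sub with rfl | hk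
        · exact hsubp.le
        · have : (k : ℕ) ≠ 1 := fun h => hk (Fin.ext (h.trans hsub.symm))
          exact hsorted k pth (by omega) (by rw [Fin.le_def]; omega)
    · cases o with
      | none => exact absurd hoS hnS
      | some k =>
        rw [hmemT] at hoT
        refine hmono _ _ ?_
        have : (k : ℕ) ≠ 0 := by
          intro h0
          rw [show k = cls from Fin.ext (h0.trans hcls.symm)] at hoS
          exact hcS hoS
        exact hsorted pth k (by omega) (by rw [Fin.le_def]; omega)
  have hcand2 : ∑ o ∈ S, ρ o * ‖featureMean (signs τ o) (jointRepresentation τ hp2 hpK β)‖ ^ 2 =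
      ∑ o ∈ T, ρ o * (1 - β) := by
    rw [jointRepresentation, sum_mul_norm_featureMean_coordinateRepresentation _ hh,
      Finset.sum_image fun i _ j _ h => leadingFeatures_injective hpK h,
      ← Finset.univ_inter (leadingPair hp2)ᶜ, ← Finset.sum_ite_mem]
    refine Finset.sum_congr rfl fun i _ => ?_
    rw [sq_sqrt_jointWeight hβ1.le, jointWeight]
    by_cases hi : i ∈ leadingPair hp2
    · have hiS : leadingFeatures hpK i ∉ S := by
        simp only [leadingPair, Finset.mem_insert, Finset.mem_singleton] at hi
        rcases hi with rfl | rfl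
        · simpa [leadingFeatures] using hnS
        · have : (⟨0, by omega⟩ : Fin K) = cls := Fin.ext hcls.symm
          simpa [leadingFeatures, this] using hcS
      simp [hi, hiS]
    · have hiS : leadingFeatures hpK i ∈ S :=
        hTS (Finset.mem_image_of_mem _ (Finset.mem_compl.2 hi))
      simp [hi, hiS]
  refine ⟨⟨_, hcand, fun Z' hZ' => ?_⟩, fun Z hZ => ?_⟩
  · rw [hcost _ hcand, hcost _ hZ', hcand2]
    linarith [(hlp Z' hZ').1]
  · have h1 := hZ.2 _ hcand
    rw [hcost _ hcand, hcost _ hZ.1, hcand2] at h1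
    have hsubS : some sub ∈ S := hTS ((hmemT sub).2 (by omega))
    have h2 := ((hlp Z hZ.1).2 (by linarith)).2 (some sub) hsubS
      (saving_lt_saving hσ hN (varianceTuple_nonneg _) hsubp)
    have h := hopt Z hZ.1
    have hsc : some sub ≠ some cls := fun h => hcS (h ▸ hsubS)
    exact ⟨h.norm_label, h2, h.inner_label, h.inner_of_norm_eq _ (by simp) hsc h2⟩

end OptimalRepresentations

/-! ### Uniform probabilities and collisions of noise directions -/

section Probability

variable {Ω : Type*} [Fintype Ω]

theorem uniformProb_nonneg (S : Set Ω) : 0 ≤ uniformProb S := by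
  unfold uniformProb; positivity

theorem uniformProb_mono {S T : Set Ω} (h : S ⊆ T) : uniformProb S ≤ uniformProb T := by
  unfold uniformProb
  have := Set.ncard_le_ncard h
  gcongr

theorem uniformProb_compl [Nonempty Ω] (S : Set Ω) : uniformProb Sᶜ = 1 - uniformProb S := by
  have h1 := Set.ncard_add_ncard_compl S
  rw [Nat.card_eq_fintype_card] at h1
  have h2 : (Fintype.card Ω : ℝ) ≠ 0 := by exact_mod_cast Fintype.card_ne_zero
  unfold uniformProb
  rw [eq_sub_iff_add_eq, ← add_div, div_eq_one_iff_eq h2]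
  exact_mod_cast (add_comm _ _).trans h1

theorem uniformProb_iUnion_le {κ : Type*} [Fintype κ] (S : κ → Set Ω) {x : ℝ}
    (hS : ∀ i, uniformProb (S i) ≤ x) : uniformProb (⋃ i, S i) ≤ Fintype.card κ * x := by
  have h1 := Set.ncard_iUnion_le_of_fintype S
  have h2 : uniformProb (⋃ i, S i) ≤ ∑ i, uniformProb (S i) := by
    unfold uniformProb
    rw [← Finset.sum_div]
    gcongr
    exact_mod_cast h1
  refine h2.trans ((Finset.sum_le_sum fun i _ => hS i).trans_eq ?_)
  simp

/-- An event that is disjoint from its image under an injection has probability at most one half. -/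
theorem uniformProb_le_half {S : Set Ω} {f : Ω → Ω} (hf : Function.Injective f)
    (hS : ∀ z ∈ S, f z ∉ S) : uniformProb S ≤ 1 / 2 := by
  have h1 : (f '' S).ncard = S.ncard := Set.ncard_image_of_injective S hf
  have h2 : f '' S ⊆ Sᶜ := by
    rintro _ ⟨z, hz, rfl⟩; exact hS z hz
  have h3 := Set.ncard_le_ncard h2
  have h4 := Set.ncard_add_ncard_compl S
  rw [Nat.card_eq_fintype_card] at h4
  unfold uniformProb
  rcases Nat.eq_zero_or_pos (Fintype.card Ω) with h0 | h0
  · rw [h0]; norm_num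
  · rw [div_le_div_iff₀ (by exact_mod_cast h0) two_pos]
    have : 2 * S.ncard ≤ Fintype.card Ω := by omega
    have : 2 * (S.ncard : ℝ) ≤ Fintype.card Ω := by exact_mod_cast this
    linarith

theorem uniformProb_preimage_snd_fst {A : Type*} [Fintype A] [Nonempty A] {q : ℕ}
    (J : Finset (Fin q)) :
    uniformProb {z : A × NoiseDraw q | z.2.1 ∈ J} = J.card / q := by
  have h1 : {z : A × NoiseDraw q | z.2.1 ∈ J} =
      ↑((Finset.univ : Finset A) ×ˢ (J ×ˢ (Finset.univ : Finset ℤˣ))) := by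
    ext; simpa using fun _ => Int.units_eq_one_or _
  have hA : (Fintype.card A : ℝ) ≠ 0 := by exact_mod_cast Fintype.card_ne_zero
  have h2 : (Fintype.card ℤˣ : ℝ) ≠ 0 := by exact_mod_cast Fintype.card_ne_zero
  unfold uniformProb
  rw [h1, Set.ncard_coe_finset, Finset.card_product, Finset.card_product, Finset.card_univ,
    Finset.card_univ, Fintype.card_prod, Fintype.card_prod, Fintype.card_fin]
  push_cast
  rw [mul_div_mul_left _ _ hA, mul_div_mul_right _ _ h2]

/-- Replacing the noise direction of `b` by an arbitrary one is injective on collisions times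
directions, since the old direction can be read off at `a`. -/
theorem uniformProb_collision_le {ι : Type*} [Fintype ι] [DecidableEq ι]
    {q : ℕ} (hq : 0 < q) {a b : ι}
    (hab : a ≠ b) :
    uniformProb {ω : ι → NoiseDraw q | (ω a).1 = (ω b).1} ≤ 1 / q := by
  set B := {ω : ι → NoiseDraw q | (ω a).1 = (ω b).1} with hB
  let f : B × Fin q → (ι → NoiseDraw q) := fun x => Function.update x.1.1 b (x.2, (x.1.1 b).2)
  have hf : Function.Injective f := by
    rintro ⟨⟨ω, hω⟩, j⟩ ⟨⟨ω', hω'⟩, j'⟩ h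
    simp only [f] at h
    have hb := congrFun h b
    simp only [Function.update_self, Prod.mk.injEq] at hb
    have ho : ∀ c, c ≠ b → ω c = ω' c := fun c hc => by
      have := congrFun h c
      simpa [hc] using this
    have hbb : ω b = ω' b := by
      refine Prod.ext ?_ hb.2
      rw [hB, Set.mem_ofPred_eq] at hω hω'
      rw [← hω, ← hω', ho a hab]
    have : ω = ω' := by
      funext c
      by_cases hc : c = b
      · rw [hc, hbb]
      · exact ho c hc
    subst this
    rw [hb.1]
  have h1 := Fintype.card_le_of_injective f hf
  rw [Fintype.card_prod, Fintype.card_fin, ← Nat.card_eq_fintype_card, Nat.card_coe_set_eq] at h1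
  have : Nonempty (Fin q) := ⟨⟨0, hq⟩⟩
  have h2 : (0 : ℝ) < Fintype.card (ι → NoiseDraw q) := by exact_mod_cast Fintype.card_pos
  unfold uniformProb
  rw [div_le_div_iff₀ h2 (by exact_mod_cast hq), one_mul]
  exact_mod_cast h1

/-- Union bound for the collisions of the noise directions. -/
theorem le_uniformProb_injective {ι : Type*} [Fintype ι] [DecidableEq ι] {q : ℕ} (hq : 0 < q) :
    1 - (Fintype.card ι : ℝ) ^ 2 / q ≤
      uniformProb {ω : ι → NoiseDraw q | Function.Injective fun a => (ω a).1} := by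
  have : Nonempty (Fin q) := ⟨⟨0, hq⟩⟩
  have h1 := uniformProb_compl {ω : ι → NoiseDraw q | Function.Injective fun a => (ω a).1}
  have h2 : {ω : ι → NoiseDraw q | Function.Injective fun a => (ω a).1}ᶜ ⊆
      ⋃ x : ι × ι, {ω : ι → NoiseDraw q | x.1 ≠ x.2 ∧ (ω x.1).1 = (ω x.2).1} := by
    intro ω hω
    rw [Set.mem_compl_iff, Set.mem_ofPred_eq, Function.Injective] at hω
    push Not at hω
    obtain ⟨a, b, h, hab⟩ := hω
    exact Set.mem_iUnion.2 ⟨(a, b), hab, h⟩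
  have h3 := uniformProb_iUnion_le
    (fun x : ι × ι => {ω : ι → NoiseDraw q | x.1 ≠ x.2 ∧ (ω x.1).1 = (ω x.2).1})
    (x := 1 / q) (fun x => by
      by_cases hx : x.1 = x.2
      · have : {ω : ι → NoiseDraw q | x.1 ≠ x.2 ∧ (ω x.1).1 = (ω x.2).1} = ∅ := by
          ext; simp [hx]
        rw [this, uniformProb, Set.ncard_empty]
        simp
      · exact (uniformProb_mono fun ω hω => hω.2).trans (uniformProb_collision_le hq hx))
  have h4 := uniformProb_mono h2
  rw [Fintype.card_prod] at h3
  push_cast at h3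
  have h5 : (Fintype.card ι : ℝ) * Fintype.card ι * (1 / q) = (Fintype.card ι : ℝ) ^ 2 / q := by
    ring
  linarith

end Probability

/-! ### Linear classifiers at test points -/

section Classification

variable {K q d p : ℕ} {v : OrthonormalBasis (Fin K ⊕ Fin q) ℝ (EuclideanSpace ℝ (Fin d))}
  {φ : Fin K → ℝ} {σ : ℝ} {Θ : Params p d} {k : Fin K}

/-- A feature whose weight vanishes cannot be predicted. -/
theorem noBetterThanRandom_of_featureWeight_eq_zero (h : featureWeight v Θ (some k) = 0) :
    NoBetterThanRandom v φ σ Θ k := by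
  intro w t
  -- Flipping the `k`-th sign does not change the output, so at most one of a test point and its
  -- flip is classified correctly.
  have hflip : ∀ z : (Fin K → ℤˣ) × NoiseDraw q,
      model Θ (dataPoint v φ σ (Function.update z.1 k (-z.1 k)) z.2) =
        model Θ (dataPoint v φ σ z.1 z.2) := by
    intro z
    rw [model_dataPoint, model_dataPoint]
    congr 1
    refine Finset.sum_congr rfl fun o _ => ?_
    rcases o with _ | l
    · rfl
    · by_cases hl : l = k
      · rw [hl, h, smul_zero, smul_zero]
      · simp [featureSign, hl]
  refine uniformProb_le_half (f := fun z => (Function.update z.1 k (-z.1 k), z.2)) ?_ ?_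
  · refine Function.Involutive.injective fun z => ?_
    simp
  · intro z hz hz'
    rw [Set.mem_ofPred_eq] at hz hz'
    simp only [hflip, Function.update_self, Units.val_neg, Int.cast_neg, neg_mul] at hz'
    linarith

/-- A feature can be predicted if some linear functional recovers its sign whenever the noise
direction of the test point avoids less than half of the noise directions. -/
theorem not_noBetterThanRandom {J : Finset (Fin q)} (hJ : 2 * J.card < q)
    (w : EuclideanSpace ℝ (Fin p))
    (hw : ∀ (τ : Fin K → ℤˣ) (ξ : NoiseDraw q), ξ.1 ∉ J →
      0 < ((τ k : ℤ) : ℝ) * inner ℝ w (model Θ (dataPoint v φ σ τ ξ))) :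
    ¬ NoBetterThanRandom v φ σ Θ k := by
  intro h
  have h1 := h w 0
  have : Nonempty (Fin q) := ⟨⟨0, by omega⟩⟩
  have h2 := uniformProb_compl {z : (Fin K → ℤˣ) × NoiseDraw q | z.2.1 ∈ J}
  rw [uniformProb_preimage_snd_fst] at h2
  have h3 : uniformProb {z : (Fin K → ℤˣ) × NoiseDraw q | z.2.1 ∈ J}ᶜ ≤
      testAccuracy v φ σ Θ k w 0 := by
    refine uniformProb_mono fun z hz => ?_
    rw [Set.mem_ofPred_eq, add_zero]
    exact hw z.1 z.2 hz
  have hq : (0 : ℝ) < q := by exact_mod_cast (by omega : 0 < q)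
  have h4 : (J.card : ℝ) / q < 1 / 2 := by
    rw [div_lt_div_iff₀ hq two_pos]
    have : (2 : ℝ) * J.card < q := by exact_mod_cast hJ
    linarith
  linarith

variable {ι : Type*} [Fintype ι] {τ : ι → Fin K → ℤˣ} {ω : ι → NoiseDraw q}

/-- The classifier is `ζ_k` itself. From `⟪ζ_k, Z⟫ = l h_k` and orthonormality, `⟪ζ_k, ζ_o⟫`
vanishes for `o ≠ k`, so only the `k`-th feature is seen. Fresh noise in an unused direction
contributes nothing, and fewer than half of the directions are used. -/
theorem not_noBetterThanRandom_of_inner [Nonempty ι] (hσ : 0 < σ) (hφ : 0 < φ k)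
    (hh : IsOrthonormalFamily (signs τ)) (hq : 2 * Fintype.card ι < q)
    {Z : ι → EuclideanSpace ℝ (Fin p)}
    (hΘ : ∀ o, featureWeight v Θ o = gain φ σ (Fintype.card ι) o • featureMean (signs τ o) Z)
    (hnoise : ∀ j, (∀ a, (ω a).1 ≠ j) → noiseWeight v Θ j = 0) {l : ℝ} (hl : 0 < l)
    (hZ : ∀ a, inner ℝ (featureMean (signs τ (some k)) Z) (Z a) = l * signs τ (some k) a) :
    ¬ NoBetterThanRandom v φ σ Θ k := by
  refine not_noBetterThanRandom (J := Finset.univ.image fun a => (ω a).1)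
    (lt_of_le_of_lt (Nat.mul_le_mul_left 2 Finset.card_image_le) hq)
    (featureMean (signs τ (some k)) Z) fun s ξ hξ => ?_
  have h1 : ∀ o, inner ℝ (featureMean (signs τ (some k)) Z) (featureMean (signs τ o) Z) =
      if o = some k then l else 0 := by
    intro o
    rw [inner_featureMean]
    simp only [hZ, mul_left_comm _ l, ← Finset.mul_expect, hh o]
    split_ifs <;> simp
  rw [model_dataPoint, hnoise ξ.1 (fun a ha => hξ (Finset.mem_image.2 ⟨a, Finset.mem_univ a, ha⟩)),
    smul_zero, add_zero, inner_sum]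
  simp only [hΘ, inner_smul_right, h1, mul_ite, mul_zero, Finset.sum_ite_eq', Finset.mem_univ,
    if_true]
  have hN : (0 : ℝ) < Fintype.card ι := by exact_mod_cast Fintype.card_pos
  have h2 : 0 < gain φ σ (Fintype.card ι) (some k) := by
    have : 0 ≤ varianceTuple φ (some k) := varianceTuple_nonneg _
    simp only [gain, featureScale]
    positivity
  have h3 : ((s k : ℤ) : ℝ) * ((s k : ℤ) : ℝ) = 1 := by rw [units_mul_cast, if_pos rfl]
  have h4 : ((s k : ℤ) : ℝ) * (featureScale φ (some k) * featureSign s (some k) *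
      (gain φ σ (Fintype.card ι) (some k) * l)) =
      φ k * gain φ σ (Fintype.card ι) (some k) * l := by
    simp only [featureScale, featureSign]
    linear_combination (φ k * gain φ σ (Fintype.card ι) (some k) * l) * h3
  rw [h4]
  positivity

/-- The gain increases with `N`, so its value at `N = 1` is a bound independent of the sample size.
-/
theorem le_gain (hσ : 0 < σ) (hφ : 0 < φ k) {N : ℝ} (hN : 1 ≤ N) :
    φ k / (σ ^ 2 + φ k ^ 2) ≤ gain φ σ N (some k) := by
  simp only [gain, featureScale, varianceTuple]
  have : 0 < N := by linarith
  rw [div_le_div_iff₀ (by positivity) (by positivity)]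
  nlinarith [mul_nonneg (sub_nonneg.2 hN) (by positivity : 0 ≤ φ k * σ ^ 2)]

theorem isOrthonormalFamily_signs {n m : ℕ} (hn : 0 < n) (hm : 0 < m) {τ : Fin n → Fin K → ℤˣ}
    (hτ : BalancedSigns τ) :
    IsOrthonormalFamily (signs fun a : Fin n × Fin m => τ a.1) := by
  have : Nonempty (Fin n) := ⟨⟨0, hn⟩⟩
  have : Nonempty (Fin m) := ⟨⟨0, hm⟩⟩
  have hprod : ∀ f : Fin n → ℝ, ∑ i, f i = 0 → 𝔼 a : Fin n × Fin m, f a.1 = 0 := by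
    intro f hf
    rw [Fintype.expect_eq_sum_div_card, Fintype.sum_prod_type]
    simp [← Finset.mul_sum, hf]
  have h0 : ∀ k, ∑ i, ((τ i k : ℤ) : ℝ) = 0 := fun k => by exact_mod_cast hτ.1 k
  rintro (_ | k) (_ | l)
  · simp [signs, featureSign]
  · simpa [signs, featureSign] using hprod _ (h0 l)
  · simpa [signs, featureSign] using hprod _ (h0 k)
  · by_cases hkl : k = l
    · subst hkl
      simp [signs, featureSign, units_mul_cast]
    · simp only [signs, featureSign, Option.some.injEq, if_neg hkl]
      exact hprod (fun i => ((τ i k : ℤ) : ℝ) * ((τ i l : ℤ) : ℝ))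
        (by exact_mod_cast hτ.2 k l hkl)

end Classification

end ContrastiveLearning

end

/-! ### The theorem, on the event of distinct noise directions -/

theorem mainTheorem1 (K p : ℕ) (hp : 3 ≤ p) (hpK : p ≤ K)
    (φ : Fin K → ℝ) (hφ : ∀ k, 0 < φ k) (σ : ℝ) (hσ : 0 < σ)
    -- the class feature, the subclass feature, and the `p`-th feature (counted from one)
    (cls sub pth : Fin K) (hcls : (cls : ℕ) = 0) (hsub : (sub : ℕ) = 1)
    (hpth : (pth : ℕ) = p - 1)
    (hsorted : ∀ k l : Fin K, 2 ≤ (k : ℕ) → k ≤ l → φ l ^ 2 ≤ φ k ^ 2)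
    (hclsub : φ cls ^ 2 < φ sub ^ 2)
    (hsupp : ¬ IsAmongLargest p (varianceTuple φ) (some cls))
    (hsubp : φ pth ^ 2 < φ sub ^ 2)
    (β : ℝ) (hβ0 : 0 < β) (hβ1 : β < 1) :
    ∃ C c : ℝ, 0 < C ∧ 0 < c ∧
      ∀ (d q n m : ℕ), 0 < q → 0 < n → 0 < m →
      ∀ (v : OrthonormalBasis (Fin K ⊕ Fin q) ℝ (EuclideanSpace ℝ (Fin d)))
        (τ : Fin n → Fin K → ℤˣ), BalancedSigns τ →
        1 - C * ((n : ℝ) ^ 2 * (m : ℝ) ^ 2 / (d : ℝ)) ≤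
          uniformProb {ω : Fin n × Fin m → NoiseDraw q |
            -- class collapse for the supervised loss
            ((∃ Θ : Params p d, IsMinNormMinimizer (lossSCL cls τ (trainingSet v φ σ τ ω)) Θ) ∧
              ∀ Θ : Params p d, IsMinNormMinimizer (lossSCL cls τ (trainingSet v φ σ τ ω)) Θ →
                alignment Θ (v (Sum.inl sub)) = 0 ∧ NoBetterThanRandom v φ σ Θ sub) ∧
            -- feature suppression for the unsupervised loss
            ((∃ Θ : Params p d, IsMinimizer (lossUCL (trainingSet v φ σ τ ω)) Θ ∧
                c ≤ alignment Θ (v (Sum.inl cls))) ∧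
              (∃ Θ : Params p d, IsMinNormMinimizer (lossUCL (trainingSet v φ σ τ ω)) Θ) ∧
              ∀ Θ : Params p d, IsMinNormMinimizer (lossUCL (trainingSet v φ σ τ ω)) Θ →
                alignment Θ (v (Sum.inl cls)) = 0) ∧
            -- the joint loss avoids both
            ((∃ Θ : Params p d,
                IsMinNormMinimizer (lossJoint β cls τ (trainingSet v φ σ τ ω)) Θ) ∧
              ∀ Θ : Params p d,
                IsMinNormMinimizer (lossJoint β cls τ (trainingSet v φ σ τ ω)) Θ →
                c ≤ alignment Θ (v (Sum.inl cls)) ∧ c ≤ alignment Θ (v (Sum.inl sub)) ∧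
                ¬ NoBetterThanRandom v φ σ Θ cls ∧ ¬ NoBetterThanRandom v φ σ Θ sub)} := by
  have hp2 : 2 ≤ p := by omega
  have hcs : sub ≠ cls := by
    intro h
    rw [h, hcls] at hsub
    exact absurd hsub (by norm_num)
  have hφc := hφ cls
  have hφs := hφ sub
  have hβ : 0 < Real.sqrt (1 - β) := Real.sqrt_pos.2 (by linarith)
  -- In `C`, the factor `K + 1` comes from `d = K + q ≤ (K + 1) q`, and the factor `2` leaves more
  -- than half of the directions unused. In `c`, the gains at `N = 1` multiply `‖ζ‖ = 1` for the
  -- class and `√(1 - β)` for the subclass.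
  refine ⟨2 * (K + 1), min (φ cls / (σ ^ 2 + φ cls ^ 2))
    (φ sub / (σ ^ 2 + φ sub ^ 2) * Real.sqrt (1 - β)), by positivity, by positivity, ?_⟩
  intro d q n m hq hn hm v τ hτ
  have : Nonempty (Fin n) := ⟨⟨0, hn⟩⟩
  have : Nonempty (Fin m) := ⟨⟨0, hm⟩⟩
  have hh := isOrthonormalFamily_signs (m := m) hn hm hτ
  have hcard : (Fintype.card (Fin n × Fin m) : ℝ) = n * m := by simp
  have hN1 : (1 : ℝ) ≤ Fintype.card (Fin n × Fin m) := by exact_mod_cast Fintype.card_pos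
  have hd : K + q = d := by
    have := Module.finrank_eq_card_basis v.toBasis
    simpa using this.symm
  have hq' : (0 : ℝ) < q := by exact_mod_cast hq
  have hd' : (d : ℝ) = K + q := by rw [← hd]; push_cast; ring
  have hdq : (d : ℝ) ≤ (K + 1) * q := by
    have h1 : (1 : ℝ) ≤ q := by exact_mod_cast hq
    have h2 : (0 : ℝ) ≤ K := K.cast_nonneg
    rw [hd']
    nlinarith
  have hd0 : (0 : ℝ) < d := by rw [hd']; positivity
  rw [← mul_pow, ← hcard]
  set N : ℝ := (Fintype.card (Fin n × Fin m) : ℝ) with hN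
  by_cases htriv : 1 - 2 * ((K : ℝ) + 1) * (N ^ 2 / d) ≤ 0
  · exact htriv.trans (uniformProb_nonneg _)
  -- A nontrivial bound means `2 (K + 1) N² < d ≤ (K + 1) q`, hence `2 N ≤ 2 N² < q`.
  have hqN : 2 * Fintype.card (Fin n × Fin m) < q := by
    rw [not_le, sub_pos, mul_div_assoc', div_lt_one hd0] at htriv
    have h2 : (0 : ℝ) < K + 1 := by positivity
    have h3 : 2 * N ^ 2 < q := lt_of_mul_lt_mul_left (by linarith) h2.le
    have h4 : 2 * N < q := by nlinarith
    rw [hN] at h4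
    exact_mod_cast h4
  refine le_trans ?_ ((le_uniformProb_injective (ι := Fin n × Fin m) hq).trans
    (uniformProb_mono fun ω hω => ?_))
  · have h1 : N ^ 2 / q ≤ (K + 1) * (N ^ 2 / d) := by
      rw [mul_div_assoc', div_le_div_iff₀ hq' hd0]
      nlinarith [sq_nonneg N]
    have h2 : 0 ≤ (K + 1) * (N ^ 2 / d) := by positivity
    linarith
  rw [Set.mem_ofPred_eq] at hω
  have hg : ∀ a b : Fin n × Fin m, b.1 = a.1 → τ b.1 = τ a.1 := fun a b h => by rw [h]
  have hgain : ∀ k, φ k / (σ ^ 2 + φ k ^ 2) ≤ gain φ σ N (some k) := fun k =>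
    le_gain hσ (hφ k) hN1
  have hgain0 : ∀ k, 0 ≤ gain φ σ N (some k) := fun k =>
    le_trans (by have := hφ k; positivity) (hgain k)
  have hL1 : ∀ Θ : Params p d, lossSCL cls τ (trainingSet v φ σ τ ω) Θ =
      pairLoss (fun a : Fin n × Fin m => τ a.1 cls)
        (representation v φ σ (fun a => τ a.1) ω Θ) := fun _ => rfl
  have hL2 : ∀ Θ : Params p d, lossUCL (trainingSet v φ σ τ ω) Θ =
      pairLoss (fun a : Fin n × Fin m => a.1)
        (representation v φ σ (fun a => τ a.1) ω Θ) := fun _ => rfl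
  have hL3 : ∀ Θ : Params p d, lossJoint β cls τ (trainingSet v φ σ τ ω) Θ =
      jointPairLoss β (fun a : Fin n × Fin m => τ a.1 cls) (fun a => a.1)
        (representation v φ σ (fun a => τ a.1) ω Θ) := fun _ => rfl
  have hucl := optimalRepresentation_example (g := fun a : Fin n × Fin m => a.1) hh hσ
    (by omega : 0 < p) hpK hg hsupp
  have hjoint := optimalRepresentation_joint (g := fun a : Fin n × Fin m => a.1) hh hσ hp hpK hg
    hcls hsub hpth hsorted hsubp hβ0 hβ1
  refine ⟨⟨?_, fun Θ hΘ => ?_⟩, ⟨?_, ?_, fun Θ hΘ => ?_⟩, ?_, fun Θ hΘ => ?_⟩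
  · obtain ⟨Z, hZ⟩ := exists_isOptimalRepresentation_label (φ := φ) (σ := σ) hh hp2 hpK hcls
    exact hZ.exists_isMinNormMinimizer hσ hω hh hL1
  · obtain ⟨hopt, hw, -⟩ := hΘ.isOptimalRepresentation hσ hω hh hL1
    have h0 : featureWeight v Θ (some sub) = 0 := by
      rw [hw, featureMean_of_isMinimizer_label hh hp2 hpK hcls hopt.1 hcs, smul_zero]
    exact ⟨by rw [alignment_eq, h0, norm_zero], noBetterThanRandom_of_featureWeight_eq_zero h0⟩
  · obtain ⟨Z, hmin, hZ⟩ := exists_isMinimizer_norm_featureMean_eq_one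
      (g := fun a : Fin n × Fin m => a.1) hh hp2 hpK hg hcls
    obtain ⟨Θ, hΘ, -, hw⟩ := exists_interpolation (v := v) (φ := φ) hσ hω hh Z
    refine ⟨Θ, (isMinimizer_iff hσ hω hh hL2 Θ).2 (by rw [hΘ]; exact hmin), ?_⟩
    rw [alignment_eq, hw, norm_smul, hZ, mul_one, Real.norm_of_nonneg (hgain0 cls)]
    exact (min_le_left _ _).trans (hgain cls)
  · obtain ⟨Z, hZ⟩ := hucl.1
    exact hZ.exists_isMinNormMinimizer hσ hω hh hL2
  · obtain ⟨hopt, hw, -⟩ := hΘ.isOptimalRepresentation hσ hω hh hL2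
    rw [alignment_eq, hw, hucl.2 _ hopt, smul_zero, norm_zero]
  · obtain ⟨Z, hZ⟩ := hjoint.1
    exact hZ.exists_isMinNormMinimizer hσ hω hh hL3
  · obtain ⟨hopt, hw, hnoise⟩ := hΘ.isOptimalRepresentation hσ hω hh hL3
    obtain ⟨hc, hs, hci, hsi⟩ := hjoint.2 _ hopt
    refine ⟨?_, ?_, ?_, ?_⟩
    · rw [alignment_eq, hw, norm_smul, ← Real.sqrt_sq (norm_nonneg (featureMean _ _)), hc,
        Real.sqrt_one, mul_one, Real.norm_of_nonneg (hgain0 cls)]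
      exact (min_le_left _ _).trans (hgain cls)
    · rw [alignment_eq, hw, norm_smul, ← Real.sqrt_sq (norm_nonneg (featureMean _ _)), hs,
        Real.norm_of_nonneg (hgain0 sub)]
      exact (min_le_right _ _).trans (mul_le_mul_of_nonneg_right (hgain sub) hβ.le)
    · exact not_noBetterThanRandom_of_inner hσ hφc hh hqN hw hnoise one_pos
        (by simpa only [one_mul] using hci)
    · exact not_noBetterThanRandom_of_inner hσ hφs hh hqN hw hnoise (sub_pos.2 hβ1) hsi
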